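/- Let $X$ be a topological space, $A,B\subseteq X$ with $X=A^\circ\cup B^\circ$, $P$ a partially ordered set, and $\{X_i\}_{i\in P}$ any filtration of $X$ (subsets with $X_i\subseteq X_j$ for $i\le j$). Put $A_i=A\cap X_i$, $B_i=B\cap X_i$, $(A\cap B)_i=A\cap B\cap X_i$ (the induced filtrations), all with the subspace topology. Let $H_k$ denote singular homology with coefficients in a commutative ring $R$ (for instance a field), and for $i\le j$ let $$H_k^{i,j}(Y)=\operatorname{im}\big(H_k(Y_i)\to H_k(Y_j)\big),\qquad H_k^{i,j}(Y,Z)=\operatorname{im}\big(H_k(Y_i,Z_i)\to H_k(Y_j,Z_j)\big)$$ be the (relative) persistent homology groups. 1. For every $k\ge 0$ and $i\in P$ there is exactly one $R$-linear map $\delta_k^i:H_{k+1}(X_i)\to H_k((A\cap B)_i)$ (the Mayer–Vietoris boundary map of $(X_i,A_i,B_i)$) such that $\delta_k^i[a+b]=[\partial b]$ whenever $a$ is a chain in $A_i$ and $b$ a chain in $B_i$ such that $a+b$ is a cycle of $X_i$ and $\partial b$ is a chain in $(A\cap B)_i$. These maps commute with the maps induced by $X_i\subseteq X_j$ and $(A\cap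 B)_i\subseteq (A\cap B)_j$; hence for $i\le j$ the map $\delta_k^j$ restricts to $\omega_k:H_{k+1}^{i,j}(X)\to H_k^{i,j}(A\cap B)$. 2. For all $k$ and $i\le j$, the inclusions induce an isomorphism $e_k:H_k^{i,j}(B,A\cap B)\to H_k^{i,j}(X,A)$. The persistent long sequences $$\cdots\to H_{k+1}^{i,j}(Y,Z)\xrightarrow{\partial}H_k^{i,j}(Z)\to H_k^{i,j}(Y)\xrightarrow{\kappa}H_k^{i,j}(Y,Z)\to\cdots$$ of the pairs $(Y,Z)=(B,A\cap B)$ and $(Y,Z)=(X,A)$, whose maps are the restrictions of those of the long exact sequences of the pairs $(Y_j,Z_j)$, are chain complexes (the image of each incoming map lies in the kernel of the outgoing one). The ladder from the first to the second, with vertical maps induced by inclusions, commutes, and $$\omega_k=\partial_B\circ e_{k+1}^{-1}\circ\kappa_X .$$ 3. For all $i\le j$ the persistent Mayer–Vietoris sequence $$\cdots\to H_{k+1}^{i,j}(X)\xrightarrow{\ \omega_k\ }H_k^{i,j}(A\cap B)\xrightarrow{(\alpha,\beta)}H_k^{i,j}(A)\oplus H_k^{i,j}(B)\xrightarrow{\gamma-\delta}H_k^{i,j}(X)\to\cdots$$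 is a chain complex, where $\alpha,\beta,\gamma,\delta$ are induced by the inclusions of $A\cap B$ into $A$ and $B$, and of $A$ and $B$ into $X$, so that $(\alpha,\beta)(x)=(x,x)$ and $(\gamma-\delta)(x,y)=x-y$. -/

import Mathlib

open CategoryTheory CategoryTheory.Limits

universe u w

namespace PersistentMV

noncomputable section

/-! ### Persistence modules and persistent groups -/

section Persistence

variable {P : Type w} [PartialOrder P] {R : Type u} [CommRing R]

/-- For a persistence module `M`, i.e. a functor from the poset `P` to `R`-modules, and `i ≤ j`,
the persistent group `M^{i,j} = im (M_i → M_j)`, a submodule of `M_j`. -/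
def persistentGroup (M : P ⥤ ModuleCat.{u} R) {i j : P} (hij : i ≤ j) :
    Submodule R (M.obj j) :=
  LinearMap.range (M.map (homOfLE hij)).hom

/-- A morphism `φ` of persistence modules maps `M^{i,j}` into `N^{i,j}`; this is the restriction
of `φ_j` to the persistent groups. -/
def persistentMap {M N : P ⥤ ModuleCat.{u} R} (φ : M ⟶ N) {i j : P} (hij : i ≤ j) :
    persistentGroup M hij →ₗ[R] persistentGroup N hij :=
  (φ.app j).hom.restrict (by
    rintro _ ⟨x, rfl⟩
    refine ⟨(φ.app i).hom x, ?_⟩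
    have h := congrArg (fun f => f.hom x) (φ.naturality (homOfLE hij))
    exact h.symm)

end Persistence

/-! ### Filtrations -/

section Filtrations

variable {X : Type u} {P : Type w} [PartialOrder P]

/-- The filtration `A_i = A ∩ X_i` induced on a subset `A` by a filtration `(X_i)` of `X`. -/
def induced (F : P →o Set X) (A : Set X) : P →o Set X where
  toFun i := A ∩ F i
  monotone' _ _ h := Set.inter_subset_inter_right A (F.monotone h)

lemma induced_le (F : P →o Set X) (A : Set X) : induced F A ≤ F :=
  fun _ => Set.inter_subset_right

lemma induced_mono (F : P →o Set X) {A B : Set X} (h : A ⊆ B) : induced F A ≤ induced F B :=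
  fun _ => Set.inter_subset_inter_left _ h

/-- `(A ∩ B)_i ⊆ A_i`. -/
lemma inter_le_left (F : P →o Set X) (A B : Set X) : induced F (A ∩ B) ≤ induced F A :=
  induced_mono F Set.inter_subset_left

/-- `(A ∩ B)_i ⊆ B_i`. -/
lemma inter_le_right (F : P →o Set X) (A B : Set X) : induced F (A ∩ B) ≤ induced F B :=
  induced_mono F Set.inter_subset_right

end Filtrations

/-! ### Singular chains and homology of subspaces and of pairs of subspaces -/

section Chains

variable {X : Type u} [TopologicalSpace X] (R : Type u) [CommRing R]

/-- The functor taking a subset of `X` to that subset with the subspace topology, and an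
inclusion of subsets to the inclusion map. -/
def subspace (X : Type u) [TopologicalSpace X] : Set X ⥤ TopCat.{u} where
  obj S := TopCat.of S
  map {S T} f := TopCat.ofHom
    (ContinuousMap.mk (Set.inclusion (leOfHom f)) (continuous_inclusion (leOfHom f)))

/-- The singular chain complex with coefficients in `R`, as a functor on the subsets of `X`. -/
def chains (X : Type u) [TopologicalSpace X] : Set X ⥤ ChainComplex (ModuleCat.{u} R) ℕ :=
  subspace X ⋙
    (AlgebraicTopology.singularChainComplexFunctor (ModuleCat.{u} R)).obj (ModuleCat.of R R)

/-- The chain map `C(S) → C(T)` induced by an inclusion `S ⊆ T`. -/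
def chainsMap {S T : Set X} (h : S ≤ T) : (chains R X).obj S ⟶ (chains R X).obj T :=
  (chains R X).map (homOfLE h)

lemma chainsMap_id (S : Set X) : chainsMap R (le_refl S) = 𝟙 ((chains R X).obj S) :=
  (chains R X).map_id S

lemma chainsMap_comp {S T U : Set X} (h : S ≤ T) (h' : T ≤ U) :
    chainsMap R h ≫ chainsMap R h' = chainsMap R (h.trans h') :=
  ((chains R X).map_comp _ _).symm

lemma mono_chainsMap {S T : Set X} (h : S ≤ T) : Mono (chainsMap R h) := by
  have : Mono ((subspace X).map (homOfLE h)) :=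
    (TopCat.mono_iff_injective _).2 (Set.inclusion_injective h)
  exact Functor.map_mono
    ((AlgebraicTopology.singularChainComplexFunctor (ModuleCat.{u} R)).obj (ModuleCat.of R R))
    ((subspace X).map (homOfLE h))

/-- The relative singular chain complex `C(S, T) = C(S) / C(T)` for `T ⊆ S`. -/
def relChains {S T : Set X} (h : T ≤ S) : ChainComplex (ModuleCat.{u} R) ℕ :=
  cokernel (chainsMap R h)

/-- The quotient map `C(S) → C(S, T)`. -/
def relChainsProj {S T : Set X} (h : T ≤ S) : (chains R X).obj S ⟶ relChains R h :=
  cokernel.π (chainsMap R h)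

lemma epi_relChainsProj {S T : Set X} (h : T ≤ S) : Epi (relChainsProj R h) :=
  (inferInstance : Epi (cokernel.π (chainsMap R h)))

/-- The chain map `C(S, T) → C(S', T')` induced by an inclusion of pairs `(S, T) ⊆ (S', T')`. -/
def relChainsMap {S T S' T' : Set X} (h : T ≤ S) (h' : T' ≤ S') (hS : S ≤ S') (hT : T ≤ T') :
    relChains R h ⟶ relChains R h' :=
  cokernel.map (chainsMap R h) (chainsMap R h') (chainsMap R hT) (chainsMap R hS)
    (by rw [chainsMap_comp, chainsMap_comp])

lemma relChainsProj_map {S T S' T' : Set X} (h : T ≤ S) (h' : T' ≤ S') (hS : S ≤ S')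
    (hT : T ≤ T') :
    relChainsProj R h ≫ relChainsMap R h h' hS hT = chainsMap R hS ≫ relChainsProj R h' :=
  cokernel.π_desc _ _ _

lemma relChainsMap_id {S T : Set X} (h : T ≤ S) :
    relChainsMap R h h le_rfl le_rfl = 𝟙 (relChains R h) := by
  have := epi_relChainsProj R h
  rw [← cancel_epi (relChainsProj R h), relChainsProj_map, chainsMap_id, Category.id_comp,
    Category.comp_id]

lemma relChainsMap_comp {S T S' T' S'' T'' : Set X} (h : T ≤ S) (h' : T' ≤ S')
    (h'' : T'' ≤ S'') (hS : S ≤ S') (hT : T ≤ T') (hS' : S' ≤ S'') (hT' : T' ≤ T'') :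
    relChainsMap R h h' hS hT ≫ relChainsMap R h' h'' hS' hT' =
      relChainsMap R h h'' (hS.trans hS') (hT.trans hT') := by
  have := epi_relChainsProj R h
  rw [← cancel_epi (relChainsProj R h), ← Category.assoc, relChainsProj_map, Category.assoc,
    relChainsProj_map, ← Category.assoc, chainsMap_comp, relChainsProj_map]

/-- The sequence of complexes `0 → C(T) → C(S) → C(S, T) → 0` of the pair `(S, T)`. -/
def pairSequence {S T : Set X} (h : T ≤ S) :
    ShortComplex (ChainComplex (ModuleCat.{u} R) ℕ) :=
  ShortComplex.mk (chainsMap R h) (relChainsProj R h) (cokernel.condition _)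

lemma pairSequence_shortExact {S T : Set X} (h : T ≤ S) : (pairSequence R h).ShortExact where
  exact := ShortComplex.exact_cokernel (chainsMap R h)
  mono_f := mono_chainsMap R h
  epi_g := (inferInstance : Epi (cokernel.π (chainsMap R h)))

/-- The morphism of sequences of pairs induced by an inclusion of pairs. -/
def pairSequenceMap {S T S' T' : Set X} (h : T ≤ S) (h' : T' ≤ S') (hS : S ≤ S')
    (hT : T ≤ T') : pairSequence R h ⟶ pairSequence R h' where
  τ₁ := chainsMap R hT
  τ₂ := chainsMap R hS
  τ₃ := relChainsMap R h h' hS hT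
  comm₁₂ := by
    change chainsMap R hT ≫ chainsMap R h' = chainsMap R h ≫ chainsMap R hS
    rw [chainsMap_comp, chainsMap_comp]
  comm₂₃ := (relChainsProj_map R h h' hS hT).symm

/-- The boundary map `H_{k+1}(S, T) → H_k(T)` of the long exact sequence of the pair. -/
def pairBoundary {S T : Set X} (h : T ≤ S) (k : ℕ) :
    (relChains R h).homology (k + 1) ⟶ ((chains R X).obj T).homology k :=
  (pairSequence_shortExact R h).δ (k + 1) k rfl

/-- `d : H_{k+1}(S) → H_k(V)` is the Mayer–Vietoris boundary map of `S = A ∪ B`, `V = A ∩ B`: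
if a cycle `z` of `S` is the sum of a chain `a` of `A` and a chain `b` of `B`, and `w` is the
cycle of `V` which equals the boundary of `b`, then `d [z] = [w]`. -/
def IsMayerVietorisBoundary {S A B V : Set X} (hA : A ≤ S) (hB : B ≤ S) (hV : V ≤ B) (k : ℕ)
    (d : ((chains R X).obj S).homology (k + 1) ⟶ ((chains R X).obj V).homology k) : Prop :=
  ∀ (z : ((chains R X).obj S).cycles (k + 1)) (a : ((chains R X).obj A).X (k + 1))
    (b : ((chains R X).obj B).X (k + 1)) (w : ((chains R X).obj V).cycles k),
    (((chains R X).obj S).iCycles (k + 1)).hom z =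
      ((chainsMap R hA).f (k + 1)).hom a + ((chainsMap R hB).f (k + 1)).hom b →
    ((chainsMap R hV).f k).hom ((((chains R X).obj V).iCycles k).hom w) =
      (((chains R X).obj B).d (k + 1) k).hom b →
    d.hom ((((chains R X).obj S).homologyπ (k + 1)).hom z) =
      (((chains R X).obj V).homologyπ k).hom w

end Chains

/-! ### Persistence modules of filtrations and of pairs of filtrations -/

section PersistentHomology

variable {X : Type u} [TopologicalSpace X] {P : Type w} [PartialOrder P] (R : Type u) [CommRing R]

/-- The persistence module `(H_k(F_i; R))_i` of a filtration. -/
def pHomology (F : P →o Set X) (k : ℕ) : P ⥤ ModuleCat.{u} R where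
  obj i := ((chains R X).obj (F i)).homology k
  map f := HomologicalComplex.homologyMap (chainsMap R (F.monotone (leOfHom f))) k
  map_id i := by rw [chainsMap_id, HomologicalComplex.homologyMap_id]
  map_comp f g := by rw [← HomologicalComplex.homologyMap_comp, chainsMap_comp]

/-- The morphism of persistence modules `(H_k(F_i) → H_k(G_i))_i` induced by the inclusions. -/
def pInclusion {F G : P →o Set X} (h : F ≤ G) (k : ℕ) : pHomology R F k ⟶ pHomology R G k where
  app i := HomologicalComplex.homologyMap (chainsMap R (h i)) k
  naturality i j f := by
    simp only [pHomology]
    rw [← HomologicalComplex.homologyMap_comp, ← HomologicalComplex.homologyMap_comp,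
      chainsMap_comp, chainsMap_comp]

/-- The persistence module `(H_k(F_i, G_i; R))_i` of a pair of filtrations. -/
def pRelHomology {F G : P →o Set X} (h : G ≤ F) (k : ℕ) : P ⥤ ModuleCat.{u} R where
  obj i := (relChains R (h i)).homology k
  map {i j} f := HomologicalComplex.homologyMap
    (relChainsMap R (h i) (h j) (F.monotone (leOfHom f)) (G.monotone (leOfHom f))) k
  map_id i := by rw [relChainsMap_id, HomologicalComplex.homologyMap_id]
  map_comp f g := by rw [← HomologicalComplex.homologyMap_comp, relChainsMap_comp]

/-- The morphism `(H_k(F_i, G_i) → H_k(F'_i, G'_i))_i` induced by inclusions of pairs. -/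
def pRelInclusion {F G F' G' : P →o Set X} (h : G ≤ F) (h' : G' ≤ F') (hF : F ≤ F')
    (hG : G ≤ G') (k : ℕ) : pRelHomology R h k ⟶ pRelHomology R h' k where
  app i := HomologicalComplex.homologyMap (relChainsMap R (h i) (h' i) (hF i) (hG i)) k
  naturality i j f := by
    simp only [pRelHomology]
    rw [← HomologicalComplex.homologyMap_comp, ← HomologicalComplex.homologyMap_comp,
      relChainsMap_comp, relChainsMap_comp]

/-- The morphism `κ = (H_k(F_i) → H_k(F_i, G_i))_i` of the sequence of a pair. -/
def pQuotient {F G : P →o Set X} (h : G ≤ F) (k : ℕ) :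
    pHomology R F k ⟶ pRelHomology R h k where
  app i := HomologicalComplex.homologyMap (relChainsProj R (h i)) k
  naturality i j f := by
    simp only [pHomology, pRelHomology]
    rw [← HomologicalComplex.homologyMap_comp, ← HomologicalComplex.homologyMap_comp,
      relChainsProj_map]

/-- The morphism `∂ = (H_{k+1}(F_i, G_i) → H_k(G_i))_i` of the sequence of a pair. -/
def pBoundary {F G : P →o Set X} (h : G ≤ F) (k : ℕ) :
    pRelHomology R h (k + 1) ⟶ pHomology R G k where
  app i := pairBoundary R (h i) k
  naturality i j f :=
    (HomologicalComplex.HomologySequence.δ_naturality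
      (pairSequenceMap R (h i) (h j) (F.monotone (leOfHom f)) (G.monotone (leOfHom f)))
      (pairSequence_shortExact R (h i)) (pairSequence_shortExact R (h j)) (k + 1) k rfl).symm

/-- For `i ≤ j`, the persistent long sequence
`⋯ → H_{k+1}^{i,j}(F, G) → H_k^{i,j}(G) → H_k^{i,j}(F) → H_k^{i,j}(F, G) → ⋯`
of a pair of filtrations is a chain complex: images of incoming maps are contained in kernels of
outgoing maps. -/
def PairSequenceIsComplex {F G : P →o Set X} (h : G ≤ F) {i j : P} (hij : i ≤ j) : Prop :=
  ∀ k : ℕ,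
    LinearMap.range (persistentMap (pBoundary R h k) hij) ≤
      LinearMap.ker (persistentMap (pInclusion R h k) hij) ∧
    LinearMap.range (persistentMap (pInclusion R h k) hij) ≤
      LinearMap.ker (persistentMap (pQuotient R h k) hij) ∧
    LinearMap.range (persistentMap (pQuotient R h (k + 1)) hij) ≤
      LinearMap.ker (persistentMap (pBoundary R h k) hij)

/-! ### The maps for a pair of subsets `A`, `B` of a filtered space -/

variable (F : P →o Set X) (A B : Set X)

/-- The excision morphism `(H_k(B_i, (A ∩ B)_i) → H_k(X_i, A_i))_i` induced by the inclusions. -/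
def pExcision (k : ℕ) :
    pRelHomology R (inter_le_right F A B) k ⟶ pRelHomology R (induced_le F A) k :=
  pRelInclusion R (inter_le_right F A B) (induced_le F A) (induced_le F B) (inter_le_left F A B) k

variable {i j : P} (hij : i ≤ j)

/-- `(α, β) : H_k^{i,j}(A ∩ B) → H_k^{i,j}(A) ⊕ H_k^{i,j}(B)`, `x ↦ (x, x)`. -/
def mvAlphaBeta (k : ℕ) :
    persistentGroup (pHomology R (induced F (A ∩ B)) k) hij →ₗ[R]
      persistentGroup (pHomology R (induced F A) k) hij ×
        persistentGroup (pHomology R (induced F B) k) hij :=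
  (persistentMap (pInclusion R (inter_le_left F A B) k) hij).prod
    (persistentMap (pInclusion R (inter_le_right F A B) k) hij)

/-- `H_k^{i,j}(A) ⊕ H_k^{i,j}(B) → H_k^{i,j}(X)`, `(x, y) ↦ x - y`. -/
def mvDifference (k : ℕ) :
    persistentGroup (pHomology R (induced F A) k) hij ×
        persistentGroup (pHomology R (induced F B) k) hij →ₗ[R]
      persistentGroup (pHomology R F k) hij :=
  (persistentMap (pInclusion R (induced_le F A) k) hij).coprod
    (-(persistentMap (pInclusion R (induced_le F B) k) hij))

end PersistentHomology

end

end PersistentMV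

open PersistentMV

/-!
The proof reduces everything to excision: for every `i` the inclusion of pairs
`(B_i, (A ∩ B)_i) → (X_i, A_i)` induces an isomorphism on homology (`excision_bijective`). These
maps are natural in `i`, so excision is an isomorphism of persistence modules, and the boundary
morphism can be defined as `H(X_i) → H(X_i, A_i) ≅ H(B_i, (A ∩ B)_i) → H((A ∩ B)_i)`
(`pMayerVietoris`). It is then natural in `i` by construction. Restriction to the persistent groups
is functorial, so each assertion about persistent groups follows from an identity between morphisms
of persistence modules, supplied by the long exact sequences of pairs and their naturality. In
general the persistent sequences are only complexes, since passing to images need not preserve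
exactness.

Excision follows from barycentric subdivision. For tuples of points of a set with a chosen centre
for every nonempty tuple, subdivision and the homotopy from the identity to it are built from cones by
recursion (`tupleSd`, `tupleHomotopy`), and the chain identities are formal consequences of
`∂ ∘ cone = id - cone ∘ ∂`. Applied to the vertices of a standard simplex and pushed forward along
singular simplices, they give natural operators on singular chains (`singSd`, `singHomotopy`).
With barycentres as centres, subdividing simplices with at most `N + 1` vertices contracts the
mutual distances of vertices by `N / (N + 1)`, so by Lebesgue's number lemma an iterated subdivision
of any chain of `X_i` is a sum of chains of `A_i` and of `B_i` (`exists_singSd_pow_mem_sup`). Such a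
decomposition turns a relative cycle of `(X_i, A_i)` into one of `(B_i, (A ∩ B)_i)`, and likewise
for relative boundaries.

The chains of tuples and the concrete singular chains `SingChain` are indexed by the number of
vertices and augmented by the empty simplex, which removes the case distinction in degree `0`: the
empty simplex lies in every subset, so that the condition on boundaries of relative `0`-chains is
void.

The same decomposition shows that a cycle of `X_i` is homologous to a sum of a chain of `A_i` and a
chain of `B_i`, which makes the boundary map unique (`IsMayerVietorisBoundary.unique`).
-/

namespace PersistentMV

/-! ### Chains of tuples and their subdivision -/

section TupleChains

variable (R : Type*) [CommRing R] {E E' : Type*}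

/-- Formal linear combinations of `n`-tuples of points of `E`. A tuple is a formal simplex with
these vertices, so that the index is the number of vertices; the complex is augmented, with the
empty tuple spanning index `0`. -/
abbrev TupleChain (R : Type*) [CommRing R] (E : Type*) (n : ℕ) : Type _ := (Fin n → E) →₀ R

/-- The boundary of a tuple: the alternating sum of the tuples with one vertex omitted. -/
noncomputable def tupleBoundary (n : ℕ) : TupleChain R E (n + 1) →ₗ[R] TupleChain R E n :=
  ∑ i : Fin (n + 1), (-1 : R) ^ (i : ℕ) • Finsupp.lmapDomain R R (fun v => v ∘ i.succAbove)

/-- The cone with apex `b`: the linear map that prepends the vertex `b` to a tuple. -/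
noncomputable def tupleCone (b : E) (n : ℕ) : TupleChain R E n →ₗ[R] TupleChain R E (n + 1) :=
  Finsupp.lmapDomain R R (fun v => (Fin.cons b v : Fin (n + 1) → E))

/-- The map of chains of tuples induced by a map of vertices. -/
noncomputable def tupleMap (f : E → E') (n : ℕ) : TupleChain R E n →ₗ[R] TupleChain R E' n :=
  Finsupp.lmapDomain R R (fun v => f ∘ v)

variable {R}

lemma tupleBoundary_single {n : ℕ} (v : Fin (n + 1) → E) :
    tupleBoundary R n (Finsupp.single v 1) =
      ∑ i : Fin (n + 1), (-1 : R) ^ (i : ℕ) • Finsupp.single (v ∘ i.succAbove) 1 := by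
  simp [tupleBoundary, Finsupp.mapDomain_single]

@[simp]
lemma tupleCone_single (b : E) {n : ℕ} (v : Fin n → E) (r : R) :
    tupleCone R b n (Finsupp.single v r) = Finsupp.single (Fin.cons b v : Fin (n + 1) → E) r := by
  simp [tupleCone, Finsupp.mapDomain_single]

@[simp]
lemma tupleMap_single (f : E → E') {n : ℕ} (v : Fin n → E) (r : R) :
    tupleMap R f n (Finsupp.single v r) = Finsupp.single (f ∘ v) r := by
  simp [tupleMap, Finsupp.mapDomain_single]

lemma tupleBoundary_tupleMap (f : E → E') (n : ℕ) (c : TupleChain R E (n + 1)) :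
    tupleBoundary R n (tupleMap R f (n + 1) c) = tupleMap R f n (tupleBoundary R n c) := by
  suffices h : tupleBoundary R n ∘ₗ tupleMap R f (n + 1) = tupleMap R f n ∘ₗ tupleBoundary R n
    from DFunLike.congr_fun h c
  refine Finsupp.lhom_ext' fun v => LinearMap.ext_ring ?_
  simp only [LinearMap.comp_apply, Finsupp.lsingle_apply, tupleMap_single, tupleBoundary_single,
    map_sum, map_smul]
  rfl

lemma tupleMap_tupleCone (f : E → E') (b : E) (n : ℕ) (c : TupleChain R E n) :
    tupleMap R f (n + 1) (tupleCone R b n c) = tupleCone R (f b) n (tupleMap R f n c) := by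
  suffices h : tupleMap R f (n + 1) ∘ₗ tupleCone R b n = tupleCone R (f b) n ∘ₗ tupleMap R f n
    from DFunLike.congr_fun h c
  refine Finsupp.lhom_ext' fun v => LinearMap.ext_ring ?_
  simp only [LinearMap.comp_apply, Finsupp.lsingle_apply, tupleMap_single, tupleCone_single]
  rw [Fin.comp_cons]

lemma tupleBoundary_tupleCone_zero (b : E) (c : TupleChain R E 0) :
    tupleBoundary R 0 (tupleCone R b 0 c) = c := by
  suffices h : tupleBoundary R 0 ∘ₗ tupleCone R b 0 = LinearMap.id from DFunLike.congr_fun h c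
  refine Finsupp.lhom_ext' fun v => LinearMap.ext_ring ?_
  simp only [LinearMap.comp_apply, Finsupp.lsingle_apply, tupleBoundary_single, tupleCone_single,
    LinearMap.id_apply]
  simp [Subsingleton.elim _ v]

lemma tupleBoundary_tupleCone_succ (b : E) (n : ℕ) (c : TupleChain R E (n + 1)) :
    tupleBoundary R (n + 1) (tupleCone R b (n + 1) c) =
      c - tupleCone R b n (tupleBoundary R n c) := by
  suffices h : tupleBoundary R (n + 1) ∘ₗ tupleCone R b (n + 1) =
      LinearMap.id - tupleCone R b n ∘ₗ tupleBoundary R n from DFunLike.congr_fun h c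
  refine Finsupp.lhom_ext' fun v => LinearMap.ext_ring ?_
  simp only [LinearMap.comp_apply, Finsupp.lsingle_apply, tupleBoundary_single, tupleCone_single,
    LinearMap.id_apply, LinearMap.sub_apply, map_sum, map_smul]
  rw [Fin.sum_univ_succ, sub_eq_add_neg, ← Finset.sum_neg_distrib]
  congr 1
  · simp only [Fin.val_zero, pow_zero, one_smul]
    rfl
  · refine Finset.sum_congr rfl fun i _ => ?_
    have : (Fin.cons b v : Fin (n + 2) → E) ∘ i.succ.succAbove =
        Fin.cons b (v ∘ i.succAbove) := by
      funext j
      cases j using Fin.cases <;> simp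
    rw [this, Fin.val_succ, pow_succ, mul_neg_one, neg_smul]

lemma tupleBoundary_tupleBoundary (n : ℕ) (c : TupleChain R E (n + 2)) :
    tupleBoundary R n (tupleBoundary R (n + 1) c) = 0 := by
  suffices h : tupleBoundary R n ∘ₗ tupleBoundary R (n + 1) =
      (0 : TupleChain R E (n + 2) →ₗ[R] _) from DFunLike.congr_fun h c
  clear c
  induction n with
  | zero =>
    refine Finsupp.lhom_ext' fun v => LinearMap.ext_ring ?_
    -- every tuple is the cone over its tail
    have : Finsupp.single v (1 : R) = tupleCone R (v 0) _ (Finsupp.single (Fin.tail v) 1) := by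
      simp
    simp only [LinearMap.comp_apply, Finsupp.lsingle_apply, LinearMap.zero_apply, this]
    rw [tupleBoundary_tupleCone_succ, map_sub, tupleBoundary_tupleCone_zero, sub_self]
  | succ n ih =>
    refine Finsupp.lhom_ext' fun v => LinearMap.ext_ring ?_
    have : Finsupp.single v (1 : R) = tupleCone R (v 0) _ (Finsupp.single (Fin.tail v) 1) := by
      simp
    simp only [LinearMap.comp_apply, Finsupp.lsingle_apply, LinearMap.zero_apply, this]
    rw [tupleBoundary_tupleCone_succ, map_sub, tupleBoundary_tupleCone_succ,
      ← LinearMap.comp_apply (tupleBoundary R n), ih]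
    simp

variable (R) (β : ∀ n : ℕ, (Fin (n + 1) → E) → E) (β' : ∀ n : ℕ, (Fin (n + 1) → E') → E')

/-- The subdivision operator for a choice `β` of a centre for every nonempty tuple: a tuple is sent
to the cone, with apex its centre, over the subdivision of its boundary. -/
noncomputable def tupleSd : ∀ n : ℕ, TupleChain R E n →ₗ[R] TupleChain R E n
  | 0 => LinearMap.id
  | n + 1 => Finsupp.linearCombination R fun v =>
      tupleCone R (β n v) n (tupleSd n (tupleBoundary R n (Finsupp.single v 1)))

/-- The chain homotopy from the identity to the subdivision operator. It vanishes on the empty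
tuple, which the subdivision operator fixes. -/
noncomputable def tupleHomotopy : ∀ n : ℕ, TupleChain R E n →ₗ[R] TupleChain R E (n + 1)
  | 0 => 0
  | n + 1 => Finsupp.linearCombination R fun v =>
      tupleCone R (β n v) (n + 1)
        (Finsupp.single v 1 - tupleHomotopy n (tupleBoundary R n (Finsupp.single v 1)))

variable {R}

lemma tupleSd_single (n : ℕ) (v : Fin (n + 1) → E) :
    tupleSd R β (n + 1) (Finsupp.single v 1) =
      tupleCone R (β n v) n (tupleSd R β n (tupleBoundary R n (Finsupp.single v 1))) := by
  rw [tupleSd, Finsupp.linearCombination_single, one_smul]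

lemma tupleHomotopy_single (n : ℕ) (v : Fin (n + 1) → E) :
    tupleHomotopy R β (n + 1) (Finsupp.single v 1) =
      tupleCone R (β n v) (n + 1)
        (Finsupp.single v 1 - tupleHomotopy R β n (tupleBoundary R n (Finsupp.single v 1))) := by
  rw [tupleHomotopy, Finsupp.linearCombination_single, one_smul]

lemma tupleBoundary_tupleSd (n : ℕ) (c : TupleChain R E (n + 1)) :
    tupleBoundary R n (tupleSd R β (n + 1) c) = tupleSd R β n (tupleBoundary R n c) := by
  suffices h : tupleBoundary R n ∘ₗ tupleSd R β (n + 1) = tupleSd R β n ∘ₗ tupleBoundary R n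
    from DFunLike.congr_fun h c
  clear c
  induction n with
  | zero =>
    refine Finsupp.lhom_ext' fun v => LinearMap.ext_ring ?_
    simp only [LinearMap.comp_apply, Finsupp.lsingle_apply, tupleSd_single,
      tupleBoundary_tupleCone_zero]
  | succ n ih =>
    refine Finsupp.lhom_ext' fun v => LinearMap.ext_ring ?_
    simp only [LinearMap.comp_apply, Finsupp.lsingle_apply]
    rw [tupleSd_single, tupleBoundary_tupleCone_succ, ← LinearMap.comp_apply (tupleBoundary R n),
      ih, LinearMap.comp_apply, tupleBoundary_tupleBoundary, map_zero, map_zero, sub_zero]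

lemma tupleBoundary_tupleHomotopy_zero (c : TupleChain R E 0) :
    tupleBoundary R 0 (tupleHomotopy R β 0 c) = c - tupleSd R β 0 c := by
  simp [tupleHomotopy, tupleSd]

lemma tupleBoundary_tupleHomotopy_succ (n : ℕ) (c : TupleChain R E (n + 1)) :
    tupleBoundary R (n + 1) (tupleHomotopy R β (n + 1) c) =
      c - tupleSd R β (n + 1) c - tupleHomotopy R β n (tupleBoundary R n c) := by
  have key : ∀ (n : ℕ), (∀ c : TupleChain R E (n + 1),
      tupleBoundary R n (tupleHomotopy R β n (tupleBoundary R n c)) =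
        tupleBoundary R n c - tupleSd R β n (tupleBoundary R n c)) →
      ∀ c : TupleChain R E (n + 1), tupleBoundary R (n + 1) (tupleHomotopy R β (n + 1) c) =
        c - tupleSd R β (n + 1) c - tupleHomotopy R β n (tupleBoundary R n c) := by
    intro n hn c
    suffices h : tupleBoundary R (n + 1) ∘ₗ tupleHomotopy R β (n + 1) =
        LinearMap.id - tupleSd R β (n + 1) - tupleHomotopy R β n ∘ₗ tupleBoundary R n
      from DFunLike.congr_fun h c
    refine Finsupp.lhom_ext' fun v => LinearMap.ext_ring ?_
    simp only [LinearMap.comp_apply, Finsupp.lsingle_apply, LinearMap.sub_apply,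
      LinearMap.id_apply]
    rw [tupleHomotopy_single, tupleBoundary_tupleCone_succ, tupleSd_single]
    simp only [map_sub, hn]
    abel
  induction n with
  | zero => exact key 0 (fun c => tupleBoundary_tupleHomotopy_zero β _) c
  | succ n ih =>
    refine key (n + 1) (fun c => ?_) c
    rw [ih, tupleBoundary_tupleBoundary, map_zero, sub_zero]

variable {β β'} {f : E → E'}

lemma tupleMap_tupleSd (hf : ∀ n v, f (β n v) = β' n (f ∘ v)) (n : ℕ)
    (c : TupleChain R E n) :
    tupleMap R f n (tupleSd R β n c) = tupleSd R β' n (tupleMap R f n c) := by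
  suffices h : tupleMap R f n ∘ₗ tupleSd R β n = tupleSd R β' n ∘ₗ tupleMap R f n
    from DFunLike.congr_fun h c
  clear c
  induction n with
  | zero => rfl
  | succ n ih =>
    refine Finsupp.lhom_ext' fun v => LinearMap.ext_ring ?_
    simp only [LinearMap.comp_apply, Finsupp.lsingle_apply, tupleMap_single]
    rw [tupleSd_single, tupleSd_single, tupleMap_tupleCone, hf,
      ← LinearMap.comp_apply (tupleMap R f n), ih, LinearMap.comp_apply,
      ← tupleBoundary_tupleMap, tupleMap_single]

lemma tupleMap_tupleHomotopy (hf : ∀ n v, f (β n v) = β' n (f ∘ v)) (n : ℕ)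
    (c : TupleChain R E n) :
    tupleMap R f (n + 1) (tupleHomotopy R β n c) = tupleHomotopy R β' n (tupleMap R f n c) := by
  suffices h : tupleMap R f (n + 1) ∘ₗ tupleHomotopy R β n =
      tupleHomotopy R β' n ∘ₗ tupleMap R f n from DFunLike.congr_fun h c
  clear c
  induction n with
  | zero => simp [tupleHomotopy]
  | succ n ih =>
    refine Finsupp.lhom_ext' fun v => LinearMap.ext_ring ?_
    simp only [LinearMap.comp_apply, Finsupp.lsingle_apply, tupleMap_single]
    rw [tupleHomotopy_single, tupleHomotopy_single, tupleMap_tupleCone, hf, map_sub,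
      ← LinearMap.comp_apply (tupleMap R f (n + 1)), ih, LinearMap.comp_apply,
      ← tupleBoundary_tupleMap, tupleMap_single]

end TupleChains

/-! ### Affine simplices in a standard simplex -/

section AffineSimplices

/-- The point of the standard simplex with barycentric coordinates `t` relative to the points
`w i`. -/
def affinePoint {n m : ℕ} (w : Fin n → stdSimplex ℝ (Fin m)) (t : stdSimplex ℝ (Fin n)) :
    stdSimplex ℝ (Fin m) :=
  ⟨∑ i, t i • (w i : Fin m → ℝ), (convex_stdSimplex ℝ (Fin m)).sum_mem (fun i _ => t.2.1 i) t.2.2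
    fun i _ => (w i).2⟩

lemma affinePoint_coe {n m : ℕ} (w : Fin n → stdSimplex ℝ (Fin m)) (t : stdSimplex ℝ (Fin n)) :
    (affinePoint w t : Fin m → ℝ) = ∑ i, t i • (w i : Fin m → ℝ) := rfl

lemma affinePoint_apply {n m : ℕ} (w : Fin n → stdSimplex ℝ (Fin m)) (t : stdSimplex ℝ (Fin n))
    (j : Fin m) : affinePoint w t j = ∑ i, t i * w i j := by
  rw [affinePoint_coe, Finset.sum_apply]
  rfl

/-- The affine singular simplex of a standard simplex with given vertices. -/
def affineSimplex {n m : ℕ} (w : Fin n → stdSimplex ℝ (Fin m)) :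
    C(stdSimplex ℝ (Fin n), stdSimplex ℝ (Fin m)) where
  toFun := affinePoint w
  continuous_toFun := by
    refine Continuous.subtype_mk (continuous_finsetSum _ fun i _ => ?_) _
    exact ((continuous_apply i).comp continuous_subtype_val).smul continuous_const

lemma affineSimplex_vertex {n m : ℕ} (w : Fin n → stdSimplex ℝ (Fin m)) (i : Fin n) :
    affineSimplex w (stdSimplex.vertex i) = w i := by
  ext j
  change affinePoint w _ j = _
  simp [affinePoint_apply, Pi.single_apply]

lemma affineSimplex_vertices (n : ℕ) :
    affineSimplex (stdSimplex.vertex : Fin n → stdSimplex ℝ (Fin n)) = ContinuousMap.id _ := by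
  ext t j
  change affinePoint _ _ j = _
  simp [affinePoint_apply, Pi.single_apply]

lemma affineSimplex_comp {n m k : ℕ} (u : Fin m → stdSimplex ℝ (Fin k))
    (w : Fin n → stdSimplex ℝ (Fin m)) :
    (affineSimplex u).comp (affineSimplex w) = affineSimplex (affineSimplex u ∘ w) := by
  ext t j
  change affinePoint u (affinePoint w t) j = affinePoint (fun i => affinePoint u (w i)) t j
  simp only [affinePoint_apply, Finset.sum_mul, Finset.mul_sum]
  rw [Finset.sum_comm]
  simp only [mul_assoc]

lemma affineSimplex_comp_vertex {n m : ℕ} (w : Fin n → stdSimplex ℝ (Fin m)) {k : ℕ}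
    (f : Fin k → Fin n) :
    (affineSimplex w).comp (affineSimplex (stdSimplex.vertex ∘ f)) = affineSimplex (w ∘ f) := by
  rw [affineSimplex_comp]
  congr 1
  funext i
  exact affineSimplex_vertex w (f i)

lemma stdSimplex_map_eq_affineSimplex {n m : ℕ} (f : Fin n → Fin m) (t : stdSimplex ℝ (Fin n)) :
    stdSimplex.map f t = affineSimplex (stdSimplex.vertex ∘ f) t := by
  ext j
  change _ = affinePoint _ _ j
  rw [affinePoint_apply, stdSimplex.map_coe, FunOnFinite.linearMap_apply_apply]
  simp [Pi.single_apply, Finset.sum_filter, eq_comm]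

/-- The barycentre of a nonempty tuple of points of a standard simplex. -/
noncomputable def tupleBarycenter (m n : ℕ) (w : Fin (n + 1) → stdSimplex ℝ (Fin m)) :
    stdSimplex ℝ (Fin m) :=
  affineSimplex w stdSimplex.barycenter

lemma affineSimplex_tupleBarycenter {m k : ℕ} (u : Fin m → stdSimplex ℝ (Fin k)) (n : ℕ)
    (w : Fin (n + 1) → stdSimplex ℝ (Fin m)) :
    affineSimplex u (tupleBarycenter m n w) = tupleBarycenter k n (affineSimplex u ∘ w) := by
  rw [tupleBarycenter, tupleBarycenter, ← affineSimplex_comp]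
  rfl

/-- A convex set containing the vertices of an affine simplex contains the simplex. -/
lemma affineSimplex_mem_of_convex {n m : ℕ} {w : Fin n → stdSimplex ℝ (Fin m)}
    {C : Set (Fin m → ℝ)} (hC : Convex ℝ C) (hw : ∀ i, (w i : Fin m → ℝ) ∈ C)
    (t : stdSimplex ℝ (Fin n)) : (affineSimplex w t : Fin m → ℝ) ∈ C :=
  hC.sum_mem (fun i _ => t.2.1 i) t.2.2 fun i _ => hw i

/-- The barycentre of `n + 1` points with mutual distances at most `r` is at distance at most
`n / (n + 1) * r` from each of them. -/
lemma dist_tupleBarycenter_le {m n : ℕ} {w : Fin (n + 1) → stdSimplex ℝ (Fin m)} {r : ℝ}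
    (hw : ∀ i j, dist (w i) (w j) ≤ r) (i : Fin (n + 1)) :
    dist (w i) (tupleBarycenter m n w) ≤ n / (n + 1) * r := by
  have hn : (0 : ℝ) < n + 1 := by positivity
  have h1 : (w i : Fin m → ℝ) - tupleBarycenter m n w =
      (n + 1 : ℝ)⁻¹ • ∑ j, ((w i : Fin m → ℝ) - w j) := by
    have h2 : (tupleBarycenter m n w : Fin m → ℝ) = (n + 1 : ℝ)⁻¹ • ∑ j, (w j : Fin m → ℝ) := by
      change (affinePoint w _ : Fin m → ℝ) = _
      rw [affinePoint_coe, Finset.smul_sum]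
      refine Finset.sum_congr rfl fun j _ => ?_
      congr 1
      change ((Fintype.card (Fin (n + 1)) : ℝ))⁻¹ = _
      simp
    rw [h2, Finset.sum_sub_distrib, smul_sub, Finset.sum_const, Finset.card_univ, Fintype.card_fin,
      ← Nat.cast_smul_eq_nsmul ℝ, smul_smul]
    push_cast
    rw [inv_mul_cancel₀ hn.ne', one_smul]
  rw [Subtype.dist_eq, dist_eq_norm]
  change ‖(w i : Fin m → ℝ) - tupleBarycenter m n w‖ ≤ _
  rw [h1, norm_smul, Real.norm_of_nonneg (by positivity),
    div_eq_inv_mul, mul_assoc]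
  refine mul_le_mul_of_nonneg_left ?_ (by positivity)
  rw [← Finset.add_sum_erase _ _ (Finset.mem_univ i), sub_self, zero_add]
  refine (norm_sum_le_of_le _ (f := fun j => (w i : Fin m → ℝ) - w j) (n := fun _ => r)
    fun j _ => ?_).trans (le_of_eq ?_)
  · rw [← dist_eq_norm]
    exact hw i j
  · rw [Finset.sum_const, Finset.card_erase_of_mem (Finset.mem_univ i)]
    simp

end AffineSimplices

/-! ### Diameters of the simplices of a subdivision -/

section Diameters

variable {R : Type*} [CommRing R]

/-- A linear map out of a free module that sends the basis vectors indexed by `s` into a submodule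
`M` sends every vector supported in `s` into `M`. -/
lemma mem_of_mem_supported {ι V : Type*} [AddCommGroup V] [Module R V] {s : Set ι}
    {M : Submodule R V} (f : (ι →₀ R) →ₗ[R] V) (h : ∀ i ∈ s, f (Finsupp.single i 1) ∈ M)
    {c : ι →₀ R} (hc : c ∈ Finsupp.supported R R s) : f c ∈ M := by
  rw [Finsupp.supported_eq_span_single] at hc
  have : Submodule.span R ((fun i => Finsupp.single i (1 : R)) '' s) ≤ M.comap f := by
    rw [Submodule.span_le]
    rintro _ ⟨i, hi, rfl⟩
    exact h i hi
  exact this hc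

lemma tupleBoundary_mem_supported {E : Type*} {n : ℕ} {v : Fin (n + 1) → E} {s : Set (Fin n → E)}
    (h : ∀ i : Fin (n + 1), v ∘ i.succAbove ∈ s) :
    tupleBoundary R n (Finsupp.single v 1) ∈ Finsupp.supported R R s := by
  rw [tupleBoundary_single]
  exact Submodule.sum_mem _ fun i _ =>
    Submodule.smul_mem _ _ (Finsupp.single_mem_supported R _ (h i))

lemma tupleCone_mem_supported {E : Type*} {b : E} {n : ℕ} {s : Set (Fin n → E)}
    {t : Set (Fin (n + 1) → E)} (h : ∀ v ∈ s, (Fin.cons b v : Fin (n + 1) → E) ∈ t)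
    {c : TupleChain R E n} (hc : c ∈ Finsupp.supported R R s) :
    tupleCone R b n c ∈ Finsupp.supported R R t :=
  mem_of_mem_supported _ (fun v hv => by
    rw [tupleCone_single]; exact Finsupp.single_mem_supported R _ (h v hv)) hc

/-- The vertices of the subdivision of a simplex lie in every convex set that contains the vertices
of the simplex. -/
lemma tupleSd_mem_supported_convex {m : ℕ} {C : Set (Fin m → ℝ)} (hC : Convex ℝ C) (n : ℕ)
    (v : Fin n → stdSimplex ℝ (Fin m)) (hv : ∀ i, (v i : Fin m → ℝ) ∈ C) :
    tupleSd R (tupleBarycenter m) n (Finsupp.single v 1) ∈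
      Finsupp.supported R R {w | ∀ i, (w i : Fin m → ℝ) ∈ C} := by
  induction n with
  | zero => exact Finsupp.single_mem_supported R _ hv
  | succ n ih =>
    rw [tupleSd_single]
    let s : Set (Fin n → stdSimplex ℝ (Fin m)) := {w | ∀ i, (w i : Fin m → ℝ) ∈ C}
    have hs : tupleSd R (tupleBarycenter m) n (tupleBoundary R n (Finsupp.single v 1)) ∈
        Finsupp.supported R R s :=
      mem_of_mem_supported (s := s) _ (fun w hw => ih w hw)
        (tupleBoundary_mem_supported fun i j => hv _)
    refine tupleCone_mem_supported ?_ hs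
    intro w hw i
    cases i using Fin.cases with
    | zero => exact affineSimplex_mem_of_convex hC hv _
    | succ i => exact hw i

/-- One subdivision contracts the mutual distances of vertices by the factor `N / (N + 1)`, for
simplices with at most `N + 1` vertices. -/
lemma tupleSd_mem_supported_dist {m N : ℕ} {r : ℝ} (hr : 0 ≤ r) (n : ℕ) (hn : n ≤ N + 1)
    (v : Fin n → stdSimplex ℝ (Fin m)) (hv : ∀ i j, dist (v i) (v j) ≤ r) :
    tupleSd R (tupleBarycenter m) n (Finsupp.single v 1) ∈
      Finsupp.supported R R {w | ∀ i j, dist (w i) (w j) ≤ N / (N + 1) * r} := by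
  induction n with
  | zero => exact Finsupp.single_mem_supported R _ (fun i => i.elim0)
  | succ n ih =>
    set q : ℝ := N / (N + 1)
    set b := tupleBarycenter m n v
    have hq : 0 ≤ q * r := by positivity
    have hb : ∀ i, dist (v i) b ≤ q * r := fun i =>
      (dist_tupleBarycenter_le hv i).trans (mul_le_mul_of_nonneg_right (by
        have : (n : ℝ) ≤ N := by exact_mod_cast Nat.le_of_succ_le_succ hn
        rw [div_le_div_iff₀ (by positivity) (by positivity)]
        nlinarith) hr)
    rw [tupleSd_single]
    -- the vertices of the subdivided boundary stay in a ball around the apex of the cone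
    let near : Set (Fin n → stdSimplex ℝ (Fin m)) :=
      {w | ∀ i, (w i : Fin m → ℝ) ∈ Metric.closedBall (b : Fin m → ℝ) (q * r)}
    have hs : tupleSd R (tupleBarycenter m) n (tupleBoundary R n (Finsupp.single v 1)) ∈
        Finsupp.supported R R (near ∩ {w | ∀ i j, dist (w i) (w j) ≤ q * r}) := by
      refine mem_of_mem_supported (s := near ∩ {w | ∀ i j, dist (w i) (w j) ≤ r}) _
        (fun w hw => ?_) (tupleBoundary_mem_supported fun i => ⟨fun j => hb _, fun j k => hv _ _⟩)
      rw [Finsupp.supported_inter]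
      exact ⟨tupleSd_mem_supported_convex (convex_closedBall _ _) n w hw.1, ih (by omega) w hw.2⟩
    refine tupleCone_mem_supported ?_ hs
    rintro w ⟨hw1, hw2⟩ i j
    have hw1' : ∀ i, dist (w i) b ≤ q * r := hw1
    cases i using Fin.cases with
    | zero =>
      cases j using Fin.cases with
      | zero => simpa using hq
      | succ j => simpa [dist_comm] using hw1' j
    | succ i =>
      cases j using Fin.cases with
      | zero => simpa using hw1' i
      | succ j => simpa using hw2 i j

/-- The `k`-fold subdivision of a simplex consists of arbitrarily small simplices for large `k`. -/
lemma exists_tupleSd_iterate_mem_supported_dist {m n : ℕ} (v : Fin n → stdSimplex ℝ (Fin m))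
    {ε : ℝ} (hε : 0 < ε) :
    ∃ k : ℕ, ((tupleSd R (tupleBarycenter m) n)^[k] (Finsupp.single v 1)) ∈
      Finsupp.supported R R {w | ∀ i j, dist (w i) (w j) < ε} := by
  set q : ℝ := n / (n + 1)
  have hq0 : 0 ≤ q := by positivity
  have hq1 : q < 1 := by rw [div_lt_one (by positivity)]; linarith
  set r : ℝ := Metric.diam (Set.univ : Set (stdSimplex ℝ (Fin m)))
  have hr : 0 ≤ r := Metric.diam_nonneg
  have key : ∀ k : ℕ, ((tupleSd R (tupleBarycenter m) n)^[k] (Finsupp.single v 1)) ∈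
      Finsupp.supported R R {w | ∀ i j, dist (w i) (w j) ≤ q ^ k * r} := by
    intro k
    induction k with
    | zero =>
      refine Finsupp.single_mem_supported R _ fun i j => ?_
      rw [pow_zero, one_mul]
      exact Metric.dist_le_diam_of_mem isCompact_univ.isBounded (Set.mem_univ _) (Set.mem_univ _)
    | succ k ih =>
      rw [Function.iterate_succ_apply']
      refine mem_of_mem_supported _ (fun w hw => ?_) ih
      rw [pow_succ', mul_assoc]
      exact tupleSd_mem_supported_dist (by positivity) n (Nat.le_succ n) w hw
  have hlim : Filter.Tendsto (fun k : ℕ => q ^ k * r) Filter.atTop (nhds 0) := by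
    simpa using (tendsto_pow_atTop_nhds_zero_of_lt_one hq0 hq1).mul_const r
  obtain ⟨k, hk⟩ := (hlim.eventually_lt_const hε).exists
  exact ⟨k, Finsupp.supported_mono (fun w hw i j => (hw i j).trans_lt hk) (key k)⟩

end Diameters

/-! ### Subdivision of singular chains -/

section SingularChains

variable (R : Type*) [CommRing R] {X : Type*} [TopologicalSpace X]

/-- Singular chains of `X`, as finitely supported functions on singular simplices. The index is the
number of vertices, so that index `n + 1` is degree `n`; index `0`, with the empty simplex as its
only basis vector, is the augmentation. -/
abbrev SingChain (R : Type*) [CommRing R] (X : Type*) [TopologicalSpace X] (n : ℕ) : Type _ :=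
  C(stdSimplex ℝ (Fin n), X) →₀ R

/-- The boundary of singular chains. -/
noncomputable def singBoundary (n : ℕ) : SingChain R X (n + 1) →ₗ[R] SingChain R X n :=
  ∑ i : Fin (n + 1), (-1 : R) ^ (i : ℕ) •
    Finsupp.lmapDomain R R (fun σ => σ.comp (affineSimplex (stdSimplex.vertex ∘ i.succAbove)))

/-- The chain map from tuples of points of a standard simplex to singular chains of `X` which sends
a tuple to the composition of a singular simplex `σ` with the affine simplex on this tuple. -/
noncomputable def pushTuple {m : ℕ} (σ : C(stdSimplex ℝ (Fin m), X)) (n : ℕ) :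
    TupleChain R (stdSimplex ℝ (Fin m)) n →ₗ[R] SingChain R X n :=
  Finsupp.lmapDomain R R (fun w => σ.comp (affineSimplex w))

/-- The universal simplex: the tuple of vertices of the standard simplex. -/
noncomputable abbrev vertexTuple (n : ℕ) : TupleChain R (stdSimplex ℝ (Fin n)) n :=
  Finsupp.single stdSimplex.vertex 1

/-- Barycentric subdivision of singular chains. -/
noncomputable def singSd (n : ℕ) : SingChain R X n →ₗ[R] SingChain R X n :=
  Finsupp.linearCombination R fun σ =>
    pushTuple R σ n (tupleSd R (tupleBarycenter n) n (vertexTuple R n))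

/-- The chain homotopy from the identity to barycentric subdivision. -/
noncomputable def singHomotopy (n : ℕ) : SingChain R X n →ₗ[R] SingChain R X (n + 1) :=
  Finsupp.linearCombination R fun σ =>
    pushTuple R σ (n + 1) (tupleHomotopy R (tupleBarycenter n) n (vertexTuple R n))

variable {R}

lemma pushTuple_single {m : ℕ} (σ : C(stdSimplex ℝ (Fin m), X)) {n : ℕ}
    (w : Fin n → stdSimplex ℝ (Fin m)) (r : R) :
    pushTuple R σ n (Finsupp.single w r) = Finsupp.single (σ.comp (affineSimplex w)) r := by
  simp [pushTuple, Finsupp.mapDomain_single]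

lemma pushTuple_vertexTuple {n : ℕ} (σ : C(stdSimplex ℝ (Fin n), X)) :
    pushTuple R σ n (vertexTuple R n) = Finsupp.single σ 1 := by
  rw [pushTuple_single, affineSimplex_vertices, ContinuousMap.comp_id]

lemma singBoundary_single {n : ℕ} (σ : C(stdSimplex ℝ (Fin (n + 1)), X)) :
    singBoundary R n (Finsupp.single σ 1) = ∑ i : Fin (n + 1), (-1 : R) ^ (i : ℕ) •
      Finsupp.single (σ.comp (affineSimplex (stdSimplex.vertex ∘ i.succAbove))) 1 := by
  simp [singBoundary, Finsupp.mapDomain_single]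

lemma singSd_single {n : ℕ} (σ : C(stdSimplex ℝ (Fin n), X)) :
    singSd R n (Finsupp.single σ 1) =
      pushTuple R σ n (tupleSd R (tupleBarycenter n) n (vertexTuple R n)) := by
  rw [singSd, Finsupp.linearCombination_single, one_smul]

lemma singHomotopy_single {n : ℕ} (σ : C(stdSimplex ℝ (Fin n), X)) :
    singHomotopy R n (Finsupp.single σ 1) =
      pushTuple R σ (n + 1) (tupleHomotopy R (tupleBarycenter n) n (vertexTuple R n)) := by
  rw [singHomotopy, Finsupp.linearCombination_single, one_smul]

lemma singBoundary_pushTuple {m : ℕ} (σ : C(stdSimplex ℝ (Fin m), X)) (n : ℕ)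
    (c : TupleChain R (stdSimplex ℝ (Fin m)) (n + 1)) :
    singBoundary R n (pushTuple R σ (n + 1) c) = pushTuple R σ n (tupleBoundary R n c) := by
  suffices h : singBoundary R n ∘ₗ pushTuple R σ (n + 1) = pushTuple R σ n ∘ₗ tupleBoundary R n
    from DFunLike.congr_fun h c
  refine Finsupp.lhom_ext' fun w => LinearMap.ext_ring ?_
  simp only [LinearMap.comp_apply, Finsupp.lsingle_apply, pushTuple_single, singBoundary_single,
    tupleBoundary_single, map_sum, map_smul, ContinuousMap.comp_assoc, affineSimplex_comp_vertex]

lemma pushTuple_comp_affineSimplex {m n : ℕ} (σ : C(stdSimplex ℝ (Fin m), X))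
    (w : Fin n → stdSimplex ℝ (Fin m)) (k : ℕ) (c : TupleChain R (stdSimplex ℝ (Fin n)) k) :
    pushTuple R (σ.comp (affineSimplex w)) k c =
      pushTuple R σ k (tupleMap R (affineSimplex w) k c) := by
  suffices h : pushTuple R (σ.comp (affineSimplex w)) k =
      pushTuple R σ k ∘ₗ tupleMap R (affineSimplex w) k from DFunLike.congr_fun h c
  refine Finsupp.lhom_ext' fun v => LinearMap.ext_ring ?_
  simp only [LinearMap.comp_apply, Finsupp.lsingle_apply, pushTuple_single, tupleMap_single,
    ContinuousMap.comp_assoc, affineSimplex_comp]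

lemma tupleMap_vertexTuple {m n : ℕ} (w : Fin n → stdSimplex ℝ (Fin m)) :
    tupleMap R (affineSimplex w) n (vertexTuple R n) = Finsupp.single w 1 := by
  rw [tupleMap_single]
  congr 1
  funext i
  exact affineSimplex_vertex w i

lemma singSd_pushTuple {m : ℕ} (σ : C(stdSimplex ℝ (Fin m), X)) (n : ℕ)
    (c : TupleChain R (stdSimplex ℝ (Fin m)) n) :
    singSd R n (pushTuple R σ n c) = pushTuple R σ n (tupleSd R (tupleBarycenter m) n c) := by
  suffices h : singSd R n ∘ₗ pushTuple R σ n = pushTuple R σ n ∘ₗ tupleSd R (tupleBarycenter m) n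
    from DFunLike.congr_fun h c
  refine Finsupp.lhom_ext' fun w => LinearMap.ext_ring ?_
  simp only [LinearMap.comp_apply, Finsupp.lsingle_apply, pushTuple_single, singSd_single]
  rw [pushTuple_comp_affineSimplex, tupleMap_tupleSd (affineSimplex_tupleBarycenter w),
    tupleMap_vertexTuple]

lemma singHomotopy_pushTuple {m : ℕ} (σ : C(stdSimplex ℝ (Fin m), X)) (n : ℕ)
    (c : TupleChain R (stdSimplex ℝ (Fin m)) n) :
    singHomotopy R n (pushTuple R σ n c) =
      pushTuple R σ (n + 1) (tupleHomotopy R (tupleBarycenter m) n c) := by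
  suffices h : singHomotopy R n ∘ₗ pushTuple R σ n =
      pushTuple R σ (n + 1) ∘ₗ tupleHomotopy R (tupleBarycenter m) n from DFunLike.congr_fun h c
  refine Finsupp.lhom_ext' fun w => LinearMap.ext_ring ?_
  simp only [LinearMap.comp_apply, Finsupp.lsingle_apply, pushTuple_single, singHomotopy_single]
  rw [pushTuple_comp_affineSimplex, tupleMap_tupleHomotopy (affineSimplex_tupleBarycenter w),
    tupleMap_vertexTuple]

lemma singBoundary_singSd (n : ℕ) (c : SingChain R X (n + 1)) :
    singBoundary R n (singSd R (n + 1) c) = singSd R n (singBoundary R n c) := by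
  suffices h : singBoundary R n ∘ₗ singSd R (n + 1) = singSd (X := X) R n ∘ₗ singBoundary R n
    from DFunLike.congr_fun h c
  refine Finsupp.lhom_ext' fun σ => LinearMap.ext_ring ?_
  simp only [LinearMap.comp_apply, Finsupp.lsingle_apply]
  rw [← pushTuple_vertexTuple σ, singSd_pushTuple, singBoundary_pushTuple, tupleBoundary_tupleSd,
    singBoundary_pushTuple, singSd_pushTuple]

lemma singBoundary_singHomotopy (n : ℕ) (c : SingChain R X (n + 1)) :
    singBoundary R (n + 1) (singHomotopy R (n + 1) c) =
      c - singSd R (n + 1) c - singHomotopy R n (singBoundary R n c) := by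
  suffices h : singBoundary R (n + 1) ∘ₗ singHomotopy R (n + 1) =
      LinearMap.id - singSd R (n + 1) - singHomotopy (X := X) R n ∘ₗ singBoundary R n
    from DFunLike.congr_fun h c
  refine Finsupp.lhom_ext' fun σ => LinearMap.ext_ring ?_
  simp only [LinearMap.comp_apply, Finsupp.lsingle_apply, LinearMap.sub_apply, LinearMap.id_apply]
  rw [← pushTuple_vertexTuple σ, singHomotopy_pushTuple, singBoundary_pushTuple,
    tupleBoundary_tupleHomotopy_succ, singBoundary_pushTuple, singSd_pushTuple,
    singHomotopy_pushTuple, map_sub, map_sub]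

/-! ### Chains in a subset and small chains -/

variable (R) in
/-- The singular chains of `X` whose simplices have image in `S`. -/
def chainsIn (S : Set X) (n : ℕ) : Submodule R (SingChain R X n) :=
  Finsupp.supported R R {σ | ∀ t, σ t ∈ S}

lemma single_mem_chainsIn {S : Set X} {n : ℕ} {σ : C(stdSimplex ℝ (Fin n), X)}
    (h : ∀ t, σ t ∈ S) (r : R) : Finsupp.single σ r ∈ chainsIn R S n :=
  Finsupp.single_mem_supported R _ h

lemma mem_chainsIn_inter {S T U : Set X} (hU : S ∩ T ⊆ U) {n : ℕ} {c : SingChain R X n}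
    (hS : c ∈ chainsIn R S n) (hT : c ∈ chainsIn R T n) : c ∈ chainsIn R U n := by
  have : c ∈ Finsupp.supported R R ({σ : C(stdSimplex ℝ (Fin n), X) | ∀ t, σ t ∈ S} ∩
      {σ | ∀ t, σ t ∈ T}) := by
    rw [Finsupp.supported_inter]
    exact ⟨hS, hT⟩
  refine Finsupp.supported_mono ?_ this
  exact fun σ hσ t => hU ⟨hσ.1 t, hσ.2 t⟩

lemma pushTuple_mem_chainsIn {S : Set X} {m : ℕ} {σ : C(stdSimplex ℝ (Fin m), X)}
    (h : ∀ t, σ t ∈ S) (n : ℕ) (c : TupleChain R (stdSimplex ℝ (Fin m)) n) :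
    pushTuple R σ n c ∈ chainsIn R S n := by
  refine mem_of_mem_supported (s := Set.univ) _ (fun w _ => ?_) (by simp)
  rw [pushTuple_single]
  refine single_mem_chainsIn ?_ 1
  exact fun t => h _

lemma singBoundary_mem_chainsIn {S : Set X} {n : ℕ} {c : SingChain R X (n + 1)}
    (hc : c ∈ chainsIn R S (n + 1)) : singBoundary R n c ∈ chainsIn R S n := by
  refine mem_of_mem_supported _ (fun σ hσ => ?_) hc
  rw [← pushTuple_vertexTuple σ, singBoundary_pushTuple]
  exact pushTuple_mem_chainsIn hσ _ _

lemma singSd_mem_chainsIn {S : Set X} {n : ℕ} {c : SingChain R X n}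
    (hc : c ∈ chainsIn R S n) : singSd R n c ∈ chainsIn R S n := by
  refine mem_of_mem_supported _ (fun σ hσ => ?_) hc
  rw [singSd_single]
  exact pushTuple_mem_chainsIn hσ _ _

lemma singHomotopy_mem_chainsIn {S : Set X} {n : ℕ} {c : SingChain R X n}
    (hc : c ∈ chainsIn R S n) : singHomotopy R n c ∈ chainsIn R S (n + 1) := by
  refine mem_of_mem_supported _ (fun σ hσ => ?_) hc
  rw [singHomotopy_single]
  exact pushTuple_mem_chainsIn hσ _ _

lemma singSd_pow_mem_chainsIn {S : Set X} {n : ℕ} {c : SingChain R X n}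
    (hc : c ∈ chainsIn R S n) (k : ℕ) : (singSd R n ^ k) c ∈ chainsIn R S n := by
  induction k with
  | zero => exact hc
  | succ k ih => rw [pow_succ', Module.End.mul_apply]; exact singSd_mem_chainsIn ih

lemma singBoundary_singSd_pow (n k : ℕ) (c : SingChain R X (n + 1)) :
    singBoundary R n ((singSd R (n + 1) ^ k) c) = (singSd R n ^ k) (singBoundary R n c) := by
  induction k generalizing c with
  | zero => rfl
  | succ k ih => rw [pow_succ, Module.End.mul_apply, ih, singBoundary_singSd, pow_succ,
      Module.End.mul_apply]

variable (R X) in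
/-- Iterated subdivision is chain homotopic to the identity, by a homotopy that preserves the chains
in every subset. -/
lemma exists_homotopy_singSd_pow (k : ℕ) :
    ∃ T : ∀ n, SingChain R X n →ₗ[R] SingChain R X (n + 1),
      (∀ n c, singBoundary R (n + 1) (T (n + 1) c) =
        c - (singSd R (n + 1) ^ k) c - T n (singBoundary R n c)) ∧
      ∀ (S : Set X) n, ∀ c ∈ chainsIn R S n, T n c ∈ chainsIn R S (n + 1) := by
  induction k with
  | zero => exact ⟨fun _ => 0, fun n c => by simp, fun S n c _ => by simp⟩
  | succ k ih =>
    obtain ⟨T, hT, hT'⟩ := ih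
    refine ⟨fun n => singHomotopy R n + T n ∘ₗ singSd R n, fun n c => ?_, fun S n c hc =>
      Submodule.add_mem _ (singHomotopy_mem_chainsIn hc) (hT' S n _ (singSd_mem_chainsIn hc))⟩
    simp only [LinearMap.add_apply, LinearMap.comp_apply, map_add, hT, singBoundary_singHomotopy,
      singBoundary_singSd, pow_succ, Module.End.mul_apply]
    abel

lemma singSd_pow_mem_sup {S T : Set X} {n : ℕ} {c : SingChain R X n}
    (hc : c ∈ chainsIn R S n ⊔ chainsIn R T n) (k : ℕ) :
    (singSd R n ^ k) c ∈ chainsIn R S n ⊔ chainsIn R T n := by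
  obtain ⟨a, ha, b, hb, rfl⟩ := Submodule.mem_sup.1 hc
  rw [map_add]
  exact Submodule.add_mem_sup (singSd_pow_mem_chainsIn ha k) (singSd_pow_mem_chainsIn hb k)

variable {A B : Set X}

/-- A singular simplex in `Y` becomes a sum of simplices in `A ∩ Y` and in `B ∩ Y` after
sufficiently many subdivisions, if the interiors of `A` and `B` cover `X`. -/
lemma exists_singSd_pow_single_mem_sup (hAB : interior A ∪ interior B = Set.univ) {Y : Set X}
    {n : ℕ} {σ : C(stdSimplex ℝ (Fin (n + 1)), X)} (hσ : ∀ t, σ t ∈ Y) :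
    ∃ k : ℕ, (singSd R (n + 1) ^ k) (Finsupp.single σ 1) ∈
      chainsIn R (A ∩ Y) (n + 1) ⊔ chainsIn R (B ∩ Y) (n + 1) := by
  -- a Lebesgue number of the cover of the standard simplex by the preimages of the interiors
  obtain ⟨ε, hε, hball⟩ := lebesgue_number_lemma_of_metric
    (s := (Set.univ : Set (stdSimplex ℝ (Fin (n + 1))))) isCompact_univ
    (c := fun b : Bool => σ ⁻¹' (if b then interior A else interior B))
    (fun b => by cases b <;> exact isOpen_interior.preimage σ.continuous)
    (fun t _ => by
      have : σ t ∈ interior A ∪ interior B := hAB ▸ Set.mem_univ _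
      rcases this with h | h
      · exact Set.mem_iUnion.2 ⟨true, h⟩
      · exact Set.mem_iUnion.2 ⟨false, h⟩)
  obtain ⟨k, hk⟩ := exists_tupleSd_iterate_mem_supported_dist (R := R)
    (stdSimplex.vertex : Fin (n + 1) → stdSimplex ℝ (Fin (n + 1))) hε
  refine ⟨k, ?_⟩
  have hpush : (singSd R (n + 1) ^ k) (Finsupp.single σ 1) = pushTuple R σ (n + 1)
      ((tupleSd R (tupleBarycenter (n + 1)) (n + 1))^[k] (vertexTuple R (n + 1))) := by
    rw [Module.End.pow_apply, ← pushTuple_vertexTuple σ]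
    exact (Function.Semiconj.iterate_right (f := pushTuple R σ (n + 1))
      (fun c => (singSd_pushTuple σ (n + 1) c).symm) k (vertexTuple R (n + 1))).symm
  rw [hpush]
  refine mem_of_mem_supported _ (fun w hw => ?_) hk
  rw [pushTuple_single]
  have hw' : ∀ t, affineSimplex w t ∈ Metric.ball (w 0) ε := fun t =>
    affineSimplex_mem_of_convex (convex_ball (w 0 : Fin (n + 1) → ℝ) ε) (fun i => hw i 0) t
  obtain ⟨b, hb⟩ := hball (w 0) (Set.mem_univ _)
  cases b with
  | true =>
    refine Submodule.mem_sup_left (single_mem_chainsIn ?_ 1)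
    exact fun t => ⟨interior_subset (hb (hw' t)), hσ _⟩
  | false =>
    refine Submodule.mem_sup_right (single_mem_chainsIn ?_ 1)
    exact fun t => ⟨interior_subset (hb (hw' t)), hσ _⟩

lemma exists_singSd_pow_mem_sup (hAB : interior A ∪ interior B = Set.univ) {Y : Set X} {n : ℕ}
    {c : SingChain R X (n + 1)} (hc : c ∈ chainsIn R Y (n + 1)) :
    ∃ k : ℕ, (singSd R (n + 1) ^ k) c ∈
      chainsIn R (A ∩ Y) (n + 1) ⊔ chainsIn R (B ∩ Y) (n + 1) := by
  rw [chainsIn, Finsupp.supported_eq_span_single] at hc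
  induction hc using Submodule.span_induction with
  | mem x hx =>
    obtain ⟨σ, hσ, rfl⟩ := hx
    exact exists_singSd_pow_single_mem_sup hAB hσ
  | zero => exact ⟨0, by simp⟩
  | add x y _ _ hx hy =>
    obtain ⟨k, hk⟩ := hx
    obtain ⟨l, hl⟩ := hy
    refine ⟨l + k, ?_⟩
    rw [map_add]
    refine Submodule.add_mem _ ?_ ?_
    · rw [pow_add, Module.End.mul_apply]
      exact singSd_pow_mem_sup hk l
    · rw [add_comm l k, pow_add, Module.End.mul_apply]
      exact singSd_pow_mem_sup hl k
  | smul r x _ hx =>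
    obtain ⟨k, hk⟩ := hx
    exact ⟨k, by rw [map_smul]; exact Submodule.smul_mem _ r hk⟩

/-! ### Excision on the level of chains -/

/-- Every relative cycle of `(Y, A ∩ Y)` is homologous to a relative cycle of
`(B ∩ Y, A ∩ B ∩ Y)`. -/
lemma exists_relCycle_of_relCycle (hAB : interior A ∪ interior B = Set.univ) {Y : Set X} {n : ℕ}
    {z : SingChain R X (n + 1)} (hz : z ∈ chainsIn R Y (n + 1))
    (hdz : singBoundary R n z ∈ chainsIn R (A ∩ Y) n) :
    ∃ a ∈ chainsIn R (A ∩ Y) (n + 1), ∃ b ∈ chainsIn R (B ∩ Y) (n + 1),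
      ∃ y ∈ chainsIn R Y (n + 2), singBoundary R n b ∈ chainsIn R ((A ∩ B) ∩ Y) n ∧
        z = a + b + singBoundary R (n + 1) y := by
  obtain ⟨k, hk⟩ := exists_singSd_pow_mem_sup hAB hz
  obtain ⟨T, hT, hT'⟩ := exists_homotopy_singSd_pow R X k
  obtain ⟨a, ha, b, hb, hab⟩ := Submodule.mem_sup.1 hk
  refine ⟨a + T n (singBoundary R n z), Submodule.add_mem _ ha (hT' _ _ _ hdz), b, hb,
    T (n + 1) z, hT' _ _ _ hz, ?_, ?_⟩
  · refine mem_chainsIn_inter (Set.inter_inter_distrib_right A B Y).ge ?_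
      (singBoundary_mem_chainsIn hb)
    rw [eq_sub_of_add_eq' hab, map_sub, singBoundary_singSd_pow]
    exact Submodule.sub_mem _ (singSd_pow_mem_chainsIn hdz k) (singBoundary_mem_chainsIn ha)
  · rw [hT, ← hab]
    abel

/-- A relative cycle of `(B ∩ Y, A ∩ B ∩ Y)` that bounds in `(Y, A ∩ Y)` already bounds in
`(B ∩ Y, A ∩ B ∩ Y)`. -/
lemma exists_relBoundary_of_relBoundary (hAB : interior A ∪ interior B = Set.univ) {Y : Set X}
    {n : ℕ} {b a : SingChain R X (n + 1)} {x : SingChain R X (n + 2)}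
    (hb : b ∈ chainsIn R (B ∩ Y) (n + 1))
    (hdb : singBoundary R n b ∈ chainsIn R ((A ∩ B) ∩ Y) n)
    (ha : a ∈ chainsIn R (A ∩ Y) (n + 1)) (hx : x ∈ chainsIn R Y (n + 2))
    (h : b = singBoundary R (n + 1) x + a) :
    ∃ c ∈ chainsIn R ((A ∩ B) ∩ Y) (n + 1), ∃ y ∈ chainsIn R (B ∩ Y) (n + 2),
      b = singBoundary R (n + 1) y + c := by
  obtain ⟨k, hk⟩ := exists_singSd_pow_mem_sup hAB hx
  obtain ⟨T, hT, hT'⟩ := exists_homotopy_singSd_pow R X k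
  obtain ⟨xA, hxA, xB, hxB, hxAB⟩ := Submodule.mem_sup.1 hk
  have hc : (singSd R (n + 1) ^ k) b - singBoundary R (n + 1) xB =
      singBoundary R (n + 1) xA + (singSd R (n + 1) ^ k) a := by
    rw [h, map_add, ← singBoundary_singSd_pow, ← hxAB, map_add]
    abel
  refine ⟨T n (singBoundary R n b) + ((singSd R (n + 1) ^ k) b - singBoundary R (n + 1) xB),
    Submodule.add_mem _ (hT' _ _ _ hdb) ?_, T (n + 1) b + xB,
    Submodule.add_mem _ (hT' _ _ _ hb) hxB, ?_⟩
  · refine mem_chainsIn_inter (Set.inter_inter_distrib_right A B Y).ge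
      ?_ (Submodule.sub_mem _ (singSd_pow_mem_chainsIn hb k) (singBoundary_mem_chainsIn hxB))
    rw [hc]
    exact Submodule.add_mem _ (singBoundary_mem_chainsIn hxA) (singSd_pow_mem_chainsIn ha k)
  · rw [map_add, hT]
    abel

end SingularChains

/-! ### Comparison with the singular chain complex of a subspace -/

section Comparison

open Simplicial

variable {X : Type u} [TopologicalSpace X]

/-- A singular simplex of a subspace `S`, as a continuous map from the standard simplex to `X`. -/
noncomputable def ambientSimplex {S : Set X} {n : ℕ}
    (x : (TopCat.toSSet.obj ((subspace X).obj S)) _⦋n⦌) : C(stdSimplex ℝ (Fin (n + 1)), X) :=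
  (ContinuousMap.mk Subtype.val continuous_subtype_val).comp
    (TopCat.toSSetObjEquiv (TopCat.of S) _ x)

lemma ambientSimplex_mem {S : Set X} {n : ℕ}
    (x : (TopCat.toSSet.obj ((subspace X).obj S)) _⦋n⦌) (t : stdSimplex ℝ (Fin (n + 1))) :
    ambientSimplex x t ∈ S :=
  (TopCat.toSSetObjEquiv (TopCat.of S) _ x t).2

lemma ambientSimplex_injective (S : Set X) (n : ℕ) : Function.Injective
    (ambientSimplex : (TopCat.toSSet.obj ((subspace X).obj S)) _⦋n⦌ → _) := by
  intro x y h
  refine (TopCat.toSSetObjEquiv (TopCat.of S) _).injective (ContinuousMap.ext fun t => ?_)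
  exact Subtype.ext (DFunLike.congr_fun h t)

lemma exists_ambientSimplex_eq {S : Set X} {n : ℕ} {σ : C(stdSimplex ℝ (Fin (n + 1)), X)}
    (h : ∀ t, σ t ∈ S) :
    ∃ x : (TopCat.toSSet.obj ((subspace X).obj S)) _⦋n⦌, ambientSimplex x = σ := by
  let τ : C(stdSimplex ℝ (Fin (n + 1)), TopCat.of S) :=
    ⟨fun t => ⟨σ t, h t⟩, σ.continuous.subtype_mk _⟩
  let e := TopCat.toSSetObjEquiv (TopCat.of S) (Opposite.op ⦋n⦌)
  refine ⟨e.symm τ, ContinuousMap.ext fun t => ?_⟩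
  exact congrArg Subtype.val (DFunLike.congr_fun (e.apply_symm_apply τ) t)

lemma ambientSimplex_δ {S : Set X} {n : ℕ}
    (x : (TopCat.toSSet.obj ((subspace X).obj S)) _⦋n + 1⦌) (i : Fin (n + 2)) :
    ambientSimplex ((TopCat.toSSet.obj ((subspace X).obj S)).δ i x) =
      (ambientSimplex x).comp (affineSimplex (stdSimplex.vertex ∘ i.succAbove)) := by
  ext t
  rw [ContinuousMap.comp_apply, ← stdSimplex_map_eq_affineSimplex]
  rfl

lemma ambientSimplex_map {S T : Set X} (h : S ≤ T) {n : ℕ}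
    (x : (TopCat.toSSet.obj ((subspace X).obj S)) _⦋n⦌) :
    ambientSimplex ((TopCat.toSSet.map ((subspace X).map (homOfLE h))).app _ x) =
      ambientSimplex x := rfl

variable (R : Type u) [CommRing R]

/-- The comparison of the singular chains of a subspace with the singular chains of `X`. -/
noncomputable def ambientChainHom (S : Set X) (n : ℕ) :
    ((chains R X).obj S).X n ⟶ ModuleCat.of R (SingChain R X (n + 1)) :=
  Cofan.IsColimit.desc
    (SSet.isColimitChainComplexXCofan (TopCat.toSSet.obj ((subspace X).obj S)) (ModuleCat.of R R) n)
    fun x => ModuleCat.ofHom (Finsupp.lsingle (ambientSimplex x))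

/-- The linear map underlying `ambientChainHom`. -/
noncomputable def ambientChain (S : Set X) (n : ℕ) :
    ((chains R X).obj S).X n →ₗ[R] SingChain R X (n + 1) := (ambientChainHom R S n).hom

/-- The inclusion of a summand of the singular chain complex of a subspace. -/
noncomputable def simplexι {S : Set X} {n : ℕ}
    (x : (TopCat.toSSet.obj ((subspace X).obj S)) _⦋n⦌) :
    ModuleCat.of R R ⟶ ((chains R X).obj S).X n :=
  SSet.ιChainComplex (R := ModuleCat.of R R) _ x

variable {R}

lemma ambientChain_simplexι {S : Set X} {n : ℕ}
    (x : (TopCat.toSSet.obj ((subspace X).obj S)) _⦋n⦌) (r : R) :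
    ambientChain R S n ((simplexι R x).hom r) = Finsupp.single (ambientSimplex x) r := by
  have h : simplexι R x ≫ ambientChainHom R S n =
      ModuleCat.ofHom (Finsupp.lsingle (ambientSimplex x)) :=
    Cofan.IsColimit.fac (SSet.isColimitChainComplexXCofan
      (TopCat.toSSet.obj ((subspace X).obj S)) (ModuleCat.of R R) n) _ x
  exact congrArg (fun f => f.hom r) h

/-- Linear maps out of the singular chains of a subspace agree if they agree on simplices. -/
lemma chains_hom_ext {S : Set X} {n : ℕ} {M : Type u} [AddCommGroup M] [Module R M]
    {f g : ((chains R X).obj S).X n →ₗ[R] M}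
    (h : ∀ x, f ((simplexι R x).hom (1 : R)) = g ((simplexι R x).hom (1 : R))) : f = g := by
  have : ModuleCat.ofHom f = ModuleCat.ofHom g :=
    SSet.chainComplex_hom_ext (X := TopCat.toSSet.obj ((subspace X).obj S))
      (R := ModuleCat.of R R) fun x => ModuleCat.hom_ext (LinearMap.ext_ring (h x))
  exact congrArg (fun f => f.hom) this

lemma ambientChain_chainsMap {S T : Set X} (h : S ≤ T) {n : ℕ} (x : ((chains R X).obj S).X n) :
    ambientChain R T n (((chainsMap R h).f n).hom x) = ambientChain R S n x := by
  suffices e : ambientChain R T n ∘ₗ ((chainsMap R h).f n).hom = ambientChain R S n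
    from DFunLike.congr_fun e x
  refine chains_hom_ext fun x => ?_
  have e : simplexι R x ≫ (chainsMap R h).f n =
      simplexι R ((TopCat.toSSet.map ((subspace X).map (homOfLE h))).app _ x) :=
    SSet.ι_chainComplexMap_f (x := x) ..
  have e' := congrArg (fun f => f.hom (1 : R)) e
  simp only [ModuleCat.hom_comp, LinearMap.comp_apply] at e'
  rw [LinearMap.comp_apply, e', ambientChain_simplexι, ambientChain_simplexι, ambientSimplex_map]

lemma ambientChain_d {S : Set X} {n : ℕ} (x : ((chains R X).obj S).X (n + 1)) :
    ambientChain R S n ((((chains R X).obj S).d (n + 1) n).hom x) =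
      singBoundary R (n + 1) (ambientChain R S (n + 1) x) := by
  suffices e : ambientChain R S n ∘ₗ (((chains R X).obj S).d (n + 1) n).hom =
      singBoundary R (n + 1) ∘ₗ ambientChain R S (n + 1) from DFunLike.congr_fun e x
  refine chains_hom_ext fun x => ?_
  have e : simplexι R x ≫ ((chains R X).obj S).d (n + 1) n =
      ∑ i : Fin (n + 2), (-1) ^ i.val •
        simplexι R ((TopCat.toSSet.obj ((subspace X).obj S)).δ i x) :=
    SSet.ιChainComplex_d (x := x) ..
  have e' := congrArg (fun f => f.hom (1 : R)) e
  simp only [ModuleCat.hom_comp, LinearMap.comp_apply, ModuleCat.hom_sum, ModuleCat.hom_zsmul,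
    LinearMap.sum_apply, LinearMap.smul_apply] at e'
  rw [LinearMap.comp_apply, e', LinearMap.comp_apply, ambientChain_simplexι, singBoundary_single,
    map_sum]
  refine Finset.sum_congr rfl fun i _ => ?_
  rw [map_zsmul, ambientChain_simplexι, ambientSimplex_δ, ← Int.cast_smul_eq_zsmul R]
  norm_cast

lemma ambientChain_injective (S : Set X) (n : ℕ) : Function.Injective (ambientChain R S n) := by
  classical
  -- a left inverse, which vanishes on the simplices that do not lie in `S`
  let g : SingChain R X (n + 1) →ₗ[R] ((chains R X).obj S).X n :=
    Finsupp.linearCombination R fun σ =>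
      if h : ∃ x : (TopCat.toSSet.obj ((subspace X).obj S)) _⦋n⦌, ambientSimplex x = σ then
        (simplexι R h.choose).hom (1 : R) else 0
  have hg : g ∘ₗ ambientChain R S n = LinearMap.id := by
    refine chains_hom_ext fun x => ?_
    rw [LinearMap.comp_apply, ambientChain_simplexι, Finsupp.linearCombination_single, one_smul,
      LinearMap.id_apply]
    have h : ∃ y : (TopCat.toSSet.obj ((subspace X).obj S)) _⦋n⦌,
      ambientSimplex y = ambientSimplex x := ⟨x, rfl⟩
    rw [dif_pos h, ambientSimplex_injective S n h.choose_spec]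
  exact Function.LeftInverse.injective (g := g) fun x => DFunLike.congr_fun hg x

lemma ambientChain_mem {S : Set X} {n : ℕ} (x : ((chains R X).obj S).X n) :
    ambientChain R S n x ∈ chainsIn R S (n + 1) := by
  have h : (chainsIn R S (n + 1)).mkQ ∘ₗ ambientChain R S n = 0 := by
    refine chains_hom_ext fun x => ?_
    rw [LinearMap.comp_apply, ambientChain_simplexι, LinearMap.zero_apply, Submodule.mkQ_apply,
      Submodule.Quotient.mk_eq_zero]
    exact single_mem_chainsIn (ambientSimplex_mem x) 1
  have := DFunLike.congr_fun h x
  rwa [LinearMap.comp_apply, LinearMap.zero_apply, Submodule.mkQ_apply,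
      Submodule.Quotient.mk_eq_zero] at this

lemma exists_ambientChain_eq {S : Set X} {n : ℕ} {c : SingChain R X (n + 1)}
    (hc : c ∈ chainsIn R S (n + 1)) : ∃ x, ambientChain R S n x = c := by
  change c ∈ LinearMap.range (ambientChain R S n)
  refine mem_of_mem_supported LinearMap.id (fun σ hσ => ?_) hc
  obtain ⟨x, rfl⟩ := exists_ambientSimplex_eq hσ
  exact ⟨(simplexι R x).hom (1 : R), ambientChain_simplexι x 1⟩

end Comparison

/-! ### Homology classes and their representatives -/

section Elements

variable {R : Type u} [CommRing R] (K L : ChainComplex (ModuleCat.{u} R) ℕ)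

lemma exists_homologyπ_eq {n : ℕ} (x : K.homology n) : ∃ z, (K.homologyπ n).hom z = x :=
  (ModuleCat.epi_iff_surjective _).1 inferInstance x

lemma iCycles_injective (n : ℕ) : Function.Injective (K.iCycles n).hom :=
  (ModuleCat.mono_iff_injective _).1 inferInstance

lemma d_iCycles (n m : ℕ) (z : K.cycles n) : (K.d n m).hom ((K.iCycles n).hom z) = 0 :=
  congrArg (fun f => f.hom z) (K.iCycles_d n m)

/-- A chain without boundary is a cycle. In degree `0` the differential in question is the zero map
`K.d 0 0`. -/
lemma exists_iCycles_eq {n : ℕ} {x : K.X n} (hx : (K.d n (n - 1)).hom x = 0) :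
    ∃ z, (K.iCycles n).hom z = x := by
  have hn : (ComplexShape.down ℕ).next n = n - 1 := by cases n <;> simp
  let k : ModuleCat.of R R ⟶ K.X n := ModuleCat.ofHom (LinearMap.toSpanSingleton R _ x)
  have hk : k ≫ K.d n (n - 1) = 0 := by
    refine ModuleCat.hom_ext (LinearMap.ext_ring ?_)
    simp [k, hx]
  refine ⟨(K.liftCycles k (n - 1) hn hk).hom (1 : R), ?_⟩
  exact (congrArg (fun f => f.hom (1 : R)) (K.liftCycles_i k (n - 1) hn hk)).trans (one_smul R x)

lemma homologyπ_eq_zero_iff {n : ℕ} (z : K.cycles n) :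
    (K.homologyπ n).hom z = 0 ↔ ∃ y, (K.d (n + 1) n).hom y = (K.iCycles n).hom z := by
  have hex : (ShortComplex.mk _ _ (K.toCycles_comp_homologyπ (n + 1) n)).Exact :=
    ShortComplex.exact_of_g_is_cokernel _ (K.homologyIsCokernel (n + 1) n (by simp))
  constructor
  · intro h
    obtain ⟨y, hy⟩ := (ShortComplex.moduleCat_exact_iff _).1 hex z h
    refine ⟨y, ?_⟩
    rw [← K.toCycles_i (n + 1) n, ModuleCat.hom_comp, LinearMap.comp_apply]
    exact congrArg _ hy
  · rintro ⟨y, hy⟩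
    have : z = (K.toCycles (n + 1) n).hom y := by
      refine iCycles_injective K n ?_
      rw [← hy, ← K.toCycles_i (n + 1) n, ModuleCat.hom_comp, LinearMap.comp_apply]
    rw [this]
    exact congrArg (fun f => f.hom y) (K.toCycles_comp_homologyπ (n + 1) n)

lemma homologyπ_eq_iff {n : ℕ} (z z' : K.cycles n) :
    (K.homologyπ n).hom z = (K.homologyπ n).hom z' ↔
      ∃ y, (K.d (n + 1) n).hom y = (K.iCycles n).hom z - (K.iCycles n).hom z' := by
  rw [← sub_eq_zero, ← map_sub, homologyπ_eq_zero_iff, map_sub]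

variable {K L} (φ : K ⟶ L)

lemma f_d_apply (n m : ℕ) (x : K.X n) :
    (φ.f m).hom ((K.d n m).hom x) = (L.d n m).hom ((φ.f n).hom x) :=
  congrArg (fun f => f.hom x) (φ.comm n m).symm

lemma iCycles_cyclesMap_apply {n : ℕ} (z : K.cycles n) :
    (L.iCycles n).hom ((HomologicalComplex.cyclesMap φ n).hom z) =
      (φ.f n).hom ((K.iCycles n).hom z) :=
  congrArg (fun f => f.hom z) (HomologicalComplex.cyclesMap_i φ n)

lemma homologyMap_homologyπ_apply {n : ℕ} (z : K.cycles n) :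
    (HomologicalComplex.homologyMap φ n).hom ((K.homologyπ n).hom z) =
      (L.homologyπ n).hom ((HomologicalComplex.cyclesMap φ n).hom z) :=
  congrArg (fun f => f.hom z) (HomologicalComplex.homologyπ_naturality φ n)

/-- Two cycles that correspond under a chain map have corresponding homology classes. -/
lemma homologyMap_homologyπ_eq {n : ℕ} {z : K.cycles n} {z' : L.cycles n}
    (h : (φ.f n).hom ((K.iCycles n).hom z) = (L.iCycles n).hom z') :
    (HomologicalComplex.homologyMap φ n).hom ((K.homologyπ n).hom z) =
      (L.homologyπ n).hom z' := by
  rw [homologyMap_homologyπ_apply]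
  congr 1
  exact iCycles_injective L n (by rw [iCycles_cyclesMap_apply, h])

/-- A criterion in terms of chains for a chain map to be bijective on homology. -/
lemma homologyMap_bijective {n : ℕ}
    (hinj : ∀ (x : K.X n) (y : L.X (n + 1)), (K.d n (n - 1)).hom x = 0 →
      (φ.f n).hom x = (L.d (n + 1) n).hom y → ∃ x', (K.d (n + 1) n).hom x' = x)
    (hsurj : ∀ z : L.X n, (L.d n (n - 1)).hom z = 0 → ∃ (x : K.X n) (y : L.X (n + 1)),
      (K.d n (n - 1)).hom x = 0 ∧ (L.d (n + 1) n).hom y = z - (φ.f n).hom x) :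
    Function.Bijective (HomologicalComplex.homologyMap φ n).hom := by
  constructor
  · rw [injective_iff_map_eq_zero]
    intro a ha
    obtain ⟨x, rfl⟩ := exists_homologyπ_eq K a
    rw [homologyMap_homologyπ_apply, homologyπ_eq_zero_iff, iCycles_cyclesMap_apply] at ha
    obtain ⟨y, hy⟩ := ha
    rw [homologyπ_eq_zero_iff]
    exact hinj _ y (d_iCycles K _ _ _) hy.symm
  · intro a
    obtain ⟨z, rfl⟩ := exists_homologyπ_eq L a
    obtain ⟨x, y, hx, hy⟩ := hsurj ((L.iCycles n).hom z) (d_iCycles L _ _ _)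
    obtain ⟨x, rfl⟩ := exists_iCycles_eq K hx
    refine ⟨(K.homologyπ n).hom x, ?_⟩
    rw [homologyMap_homologyπ_apply, eq_comm, homologyπ_eq_iff, iCycles_cyclesMap_apply]
    exact ⟨y, hy⟩

end Elements

/-! ### Relative chains and excision -/

section Pairs

variable {X : Type u} [TopologicalSpace X] {R : Type u} [CommRing R] {S T : Set X} (h : T ≤ S)

lemma relChainsProj_surjective (n : ℕ) :
    Function.Surjective ((relChainsProj R h).f n).hom := by
  have := epi_relChainsProj R h
  exact (ModuleCat.epi_iff_surjective _).1 inferInstance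

lemma relChainsProj_eq_zero_iff {n : ℕ} (x : ((chains R X).obj S).X n) :
    ((relChainsProj R h).f n).hom x = 0 ↔ ambientChain R S n x ∈ chainsIn R T (n + 1) := by
  have hex : ((pairSequence R h).map (HomologicalComplex.eval _ _ n)).Exact :=
    (pairSequence_shortExact R h).exact.map _
  constructor
  · intro hx
    obtain ⟨t, rfl⟩ : ∃ t : ((chains R X).obj T).X n, ((chainsMap R h).f n).hom t = x :=
      (ShortComplex.moduleCat_exact_iff _).1 hex x hx
    rw [ambientChain_chainsMap]
    exact ambientChain_mem t
  · intro hx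
    obtain ⟨t, ht⟩ := exists_ambientChain_eq hx
    have : x = ((chainsMap R h).f n).hom t :=
      ambientChain_injective S n (by rw [ambientChain_chainsMap, ht])
    rw [this]
    exact congrArg (fun f => (f.f n).hom t) (pairSequence R h).zero

lemma relChainsProj_eq_iff {n : ℕ} (x y : ((chains R X).obj S).X n) :
    ((relChainsProj R h).f n).hom x = ((relChainsProj R h).f n).hom y ↔
      ambientChain R S n x - ambientChain R S n y ∈ chainsIn R T (n + 1) := by
  rw [← sub_eq_zero, ← map_sub, relChainsProj_eq_zero_iff, map_sub]

/-- A relative chain is a cycle if and only if its boundary lies in the smaller subspace. In degree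
`0` both conditions are void: the only simplex of the augmentation is the empty one, which lies in
every subspace. -/
lemma d_relChainsProj_eq_zero_iff {n : ℕ} (x : ((chains R X).obj S).X n) :
    ((relChains R h).d n (n - 1)).hom (((relChainsProj R h).f n).hom x) = 0 ↔
      singBoundary R n (ambientChain R S n x) ∈ chainsIn R T n := by
  cases n with
  | zero =>
    refine iff_of_true ?_ ?_
    · rw [(relChains R h).shape 0 (0 - 1) (by simp)]
      rfl
    · have : {σ : C(stdSimplex ℝ (Fin 0), X) | ∀ t, σ t ∈ T} = Set.univ := by
        refine Set.eq_univ_of_forall fun σ t => ?_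
        exact absurd t.2.2 (by simp)
      rw [chainsIn, this, Finsupp.supported_univ]
      trivial
  | succ n =>
    rw [← ambientChain_d, ← relChainsProj_eq_zero_iff h, f_d_apply]
    rfl

lemma relChainsMap_relChainsProj {S' T' : Set X} (h' : T' ≤ S') (hS : S ≤ S') (hT : T ≤ T') {n : ℕ}
    (x : ((chains R X).obj S).X n) :
    ((relChainsMap R h h' hS hT).f n).hom (((relChainsProj R h).f n).hom x) =
      ((relChainsProj R h').f n).hom (((chainsMap R hS).f n).hom x) :=
  congrArg (fun f => (f.f n).hom x) (relChainsProj_map R h h' hS hT)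

/-- The boundary map of a pair: a relative cycle represented by a chain `b` is sent to the class of
the boundary of `b`. -/
lemma pairBoundary_apply {k : ℕ} {y : (relChains R h).cycles (k + 1)}
    {b : ((chains R X).obj S).X (k + 1)} {w : ((chains R X).obj T).cycles k}
    (hb : ((relChainsProj R h).f (k + 1)).hom b = ((relChains R h).iCycles (k + 1)).hom y)
    (hw : ((chainsMap R h).f k).hom ((((chains R X).obj T).iCycles k).hom w) =
      (((chains R X).obj S).d (k + 1) k).hom b) :
    (pairBoundary R h k).hom (((relChains R h).homologyπ (k + 1)).hom y) =
      (((chains R X).obj T).homologyπ k).hom w := by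
  refine (pairSequence_shortExact R h).δ_apply' (k + 1) k rfl
    (((relChains R h).homologyπ (k + 1)).hom y)
    ((((chains R X).obj S).pOpcycles (k + 1)).hom b) w ?_ ?_
  · have h1 := congrArg (fun f => f.hom b)
      (HomologicalComplex.p_opcyclesMap (relChainsProj R h) (k + 1))
    have h2 := congrArg (fun f => f.hom y) ((relChains R h).homology_π_ι (k + 1))
    refine h1.trans (Eq.trans ?_ h2.symm)
    exact congrArg ((relChains R h).pOpcycles (k + 1)).hom hb
  · refine iCycles_injective ((chains R X).obj S) k ?_
    have h1 := iCycles_cyclesMap_apply (chainsMap R h) w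
    have h2 := congrArg (fun f => f.hom b) (((chains R X).obj S).pOpcycles_opcyclesToCycles_assoc
      (k + 1) k (((chains R X).obj S).iCycles k))
    have h3 := congrArg (fun f => f.hom b) (((chains R X).obj S).toCycles_i (k + 1) k)
    exact h1.trans (hw.trans (h2.trans h3).symm)

/-- Excision: if the interiors of `A` and `B` cover `X`, the inclusion of
`(B ∩ Y, A ∩ B ∩ Y)` into `(Y, A ∩ Y)` is bijective on homology. -/
lemma excision_bijective {A B : Set X} (hAB : interior A ∪ interior B = Set.univ) {Y : Set X}
    (h : A ∩ B ∩ Y ≤ B ∩ Y) (h' : A ∩ Y ≤ Y) (hS : B ∩ Y ≤ Y) (hT : A ∩ B ∩ Y ≤ A ∩ Y) (n : ℕ) :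
    Function.Bijective
      (HomologicalComplex.homologyMap (relChainsMap R h h' hS hT) n).hom := by
  refine homologyMap_bijective _ (fun b x hb hbx => ?_) fun z hz => ?_
  · obtain ⟨b, rfl⟩ := relChainsProj_surjective h n b
    obtain ⟨x, rfl⟩ := relChainsProj_surjective h' (n + 1) x
    rw [d_relChainsProj_eq_zero_iff] at hb
    rw [relChainsMap_relChainsProj, ← f_d_apply, relChainsProj_eq_iff, ambientChain_chainsMap,
      ambientChain_d] at hbx
    obtain ⟨c, hc, y, hy, hbc⟩ := exists_relBoundary_of_relBoundary hAB (ambientChain_mem b) hb hbx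
      (ambientChain_mem x) (add_sub_cancel _ _).symm
    obtain ⟨y, rfl⟩ := exists_ambientChain_eq hy
    refine ⟨((relChainsProj R h).f (n + 1)).hom y, ?_⟩
    rw [← f_d_apply, eq_comm, relChainsProj_eq_iff, ambientChain_d, hbc, add_sub_cancel_left]
    exact hc
  · obtain ⟨z, rfl⟩ := relChainsProj_surjective h' n z
    rw [d_relChainsProj_eq_zero_iff] at hz
    obtain ⟨a, ha, b, hb, y, hy, hdb, hzab⟩ :=
      exists_relCycle_of_relCycle hAB (ambientChain_mem z) hz
    obtain ⟨b, rfl⟩ := exists_ambientChain_eq hb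
    obtain ⟨y, rfl⟩ := exists_ambientChain_eq hy
    refine ⟨((relChainsProj R h).f n).hom b, ((relChainsProj R h').f (n + 1)).hom y,
      (d_relChainsProj_eq_zero_iff h b).2 hdb, ?_⟩
    rw [relChainsMap_relChainsProj, ← map_sub, ← f_d_apply, eq_comm, relChainsProj_eq_iff, map_sub,
      ambientChain_chainsMap, ambientChain_d, hzab]
    convert ha using 1
    abel

end Pairs

/-! ### Restriction to persistent groups -/

section PersistentMaps

variable {P : Type w} [PartialOrder P] {R : Type u} [CommRing R] {L M N : P ⥤ ModuleCat.{u} R}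

lemma persistentMap_comp (φ : L ⟶ M) (ψ : M ⟶ N) {i j : P} (hij : i ≤ j) :
    persistentMap (φ ≫ ψ) hij = persistentMap ψ hij ∘ₗ persistentMap φ hij := rfl

lemma range_persistentMap_le_ker {φ : L ⟶ M} {ψ : M ⟶ N} (h : φ ≫ ψ = 0) {i j : P}
    (hij : i ≤ j) :
    LinearMap.range (persistentMap φ hij) ≤ LinearMap.ker (persistentMap ψ hij) := by
  rw [LinearMap.range_le_ker_iff, ← persistentMap_comp, h]
  rfl

lemma persistentMap_bijective (φ : L ⟶ M) [IsIso φ] {i j : P} (hij : i ≤ j) :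
    Function.Bijective (persistentMap φ hij) := by
  refine Function.bijective_iff_has_inverse.2 ⟨persistentMap (inv φ) hij, fun x => ?_, fun x => ?_⟩
  · have : persistentMap (inv φ) hij ∘ₗ persistentMap φ hij = LinearMap.id := by
      rw [← persistentMap_comp, IsIso.hom_inv_id]
      rfl
    exact DFunLike.congr_fun this x
  · have : persistentMap φ hij ∘ₗ persistentMap (inv φ) hij = LinearMap.id := by
      rw [← persistentMap_comp, IsIso.inv_hom_id]
      rfl
    exact DFunLike.congr_fun this x

end PersistentMaps

/-! ### Morphisms of persistence modules of filtrations -/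

section FiltrationMorphisms

variable {X : Type u} [TopologicalSpace X] {P : Type w} [PartialOrder P] (R : Type u) [CommRing R]

lemma pInclusion_comp {F G H : P →o Set X} (h : F ≤ G) (h' : G ≤ H) (k : ℕ) :
    pInclusion R h k ≫ pInclusion R h' k = pInclusion R (h.trans h') k := by
  ext i : 2
  exact (HomologicalComplex.homologyMap_comp _ _ k).symm.trans
    (congrArg (fun f => HomologicalComplex.homologyMap f k) (chainsMap_comp R (h i) (h' i)))

lemma pBoundary_comp_pInclusion {F G : P →o Set X} (h : G ≤ F) (k : ℕ) :
    pBoundary R h k ≫ pInclusion R h k = 0 := by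
  ext i : 2
  exact (pairSequence_shortExact R (h i)).δ_comp (k + 1) k rfl

lemma pInclusion_comp_pQuotient {F G : P →o Set X} (h : G ≤ F) (k : ℕ) :
    pInclusion R h k ≫ pQuotient R h k = 0 := by
  ext i : 2
  refine (HomologicalComplex.homologyMap_comp _ _ k).symm.trans ?_
  rw [show chainsMap R (h i) ≫ relChainsProj R (h i) = 0 from (pairSequence R (h i)).zero,
    HomologicalComplex.homologyMap_zero]
  rfl

lemma pQuotient_comp_pBoundary {F G : P →o Set X} (h : G ≤ F) (k : ℕ) :
    pQuotient R h (k + 1) ≫ pBoundary R h k = 0 := by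
  ext i : 2
  exact (pairSequence_shortExact R (h i)).comp_δ (k + 1) k rfl

lemma pairSequenceIsComplex {F G : P →o Set X} (h : G ≤ F) {i j : P} (hij : i ≤ j) :
    PairSequenceIsComplex R h hij := fun k =>
  ⟨range_persistentMap_le_ker (pBoundary_comp_pInclusion R h k) hij,
    range_persistentMap_le_ker (pInclusion_comp_pQuotient R h k) hij,
    range_persistentMap_le_ker (pQuotient_comp_pBoundary R h k) hij⟩

lemma pQuotient_comp_pRelInclusion {F G F' G' : P →o Set X} (h : G ≤ F) (h' : G' ≤ F')
    (hF : F ≤ F') (hG : G ≤ G') (k : ℕ) :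
    pQuotient R h k ≫ pRelInclusion R h h' hF hG k = pInclusion R hF k ≫ pQuotient R h' k := by
  ext i : 2
  exact (HomologicalComplex.homologyMap_comp _ _ k).symm.trans
    ((congrArg (fun f => HomologicalComplex.homologyMap f k)
      (relChainsProj_map R (h i) (h' i) (hF i) (hG i))).trans
      (HomologicalComplex.homologyMap_comp _ _ k))

lemma pBoundary_comp_pInclusion_eq {F G F' G' : P →o Set X} (h : G ≤ F) (h' : G' ≤ F')
    (hF : F ≤ F') (hG : G ≤ G') (k : ℕ) :
    pBoundary R h k ≫ pInclusion R hG k =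
      pRelInclusion R h h' hF hG (k + 1) ≫ pBoundary R h' k := by
  ext i : 2
  exact HomologicalComplex.HomologySequence.δ_naturality
    (pairSequenceMap R (h i) (h' i) (hF i) (hG i))
    (pairSequence_shortExact R (h i)) (pairSequence_shortExact R (h' i)) (k + 1) k rfl

/-! ### The persistent Mayer–Vietoris boundary map -/

variable (F : P →o Set X) (A B : Set X)

lemma isIso_pExcision (hAB : interior A ∪ interior B = Set.univ) (k : ℕ) :
    IsIso (pExcision R F A B k) := by
  have : ∀ i, IsIso ((pExcision R F A B k).app i) := fun i => by
    rw [ConcreteCategory.isIso_iff_bijective]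
    exact excision_bijective hAB _ _ _ _ k
  exact NatIso.isIso_of_isIso_app _

/-- The morphism `H_{k+1}(X_i) → H_{k+1}(X_i, A_i) ≅ H_{k+1}(B_i, (A ∩ B)_i) → H_k((A ∩ B)_i)`. -/
noncomputable def pMayerVietoris (hAB : interior A ∪ interior B = Set.univ) (k : ℕ) :
    pHomology R F (k + 1) ⟶ pHomology R (induced F (A ∩ B)) k :=
  haveI := isIso_pExcision R F A B hAB (k + 1)
  pQuotient R (induced_le F A) (k + 1) ≫ inv (pExcision R F A B (k + 1)) ≫
    pBoundary R (inter_le_right F A B) k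

variable {R F A B}

lemma pMayerVietoris_comp (hAB : interior A ∪ interior B = Set.univ) (k : ℕ) {i : P}
    {x : (pHomology R F (k + 1)).obj i}
    {y : (pRelHomology R (inter_le_right F A B) (k + 1)).obj i}
    (h : ((pQuotient R (induced_le F A) (k + 1)).app i).hom x =
      ((pExcision R F A B (k + 1)).app i).hom y) :
    ((pMayerVietoris R F A B hAB k).app i).hom x =
      ((pBoundary R (inter_le_right F A B) k).app i).hom y := by
  have := isIso_pExcision R F A B hAB (k + 1)
  have e := congrArg (fun f => (f.app i).hom y) (IsIso.hom_inv_id (pExcision R F A B (k + 1)))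
  simp only [NatTrans.comp_app, ModuleCat.hom_comp, LinearMap.comp_apply] at e
  simp only [pMayerVietoris, NatTrans.comp_app, ModuleCat.hom_comp, LinearMap.comp_apply]
  rw [h, e]
  rfl

lemma isMayerVietorisBoundary_pMayerVietoris (hAB : interior A ∪ interior B = Set.univ) (k : ℕ)
    (i : P) :
    IsMayerVietorisBoundary R (induced_le F A i) (induced_le F B i) (inter_le_right F A B i) k
      ((pMayerVietoris R F A B hAB k).app i) := by
  intro z a b w hz hw
  -- the chain `b` represents a relative cycle of `(B_i, (A ∩ B)_i)`
  have hb : ((relChains R (inter_le_right F A B i)).d (k + 1) k).hom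
      (((relChainsProj R (inter_le_right F A B i)).f (k + 1)).hom b) = 0 := by
    rw [← f_d_apply, ← hw, relChainsProj_eq_zero_iff, ambientChain_chainsMap]
    exact ambientChain_mem _
  obtain ⟨y, hy⟩ := exists_iCycles_eq (relChains R (inter_le_right F A B i)) (n := k + 1) hb
  refine (pMayerVietoris_comp hAB k (y := ((relChains R _).homologyπ (k + 1)).hom y) ?_).trans
    (pairBoundary_apply _ hy.symm hw)
  -- in `C(X_i, A_i)` the images of `b` and `z` agree, since `z - b` is the chain `a` of `A_i`
  refine (homologyMap_homologyπ_eq (relChainsProj R (induced_le F A i)) (z' :=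
    (HomologicalComplex.cyclesMap (relChainsMap R (inter_le_right F A B i) (induced_le F A i)
      (induced_le F B i) (inter_le_left F A B i)) (k + 1)).hom y) ?_).trans
    (homologyMap_homologyπ_apply _ y).symm
  rw [iCycles_cyclesMap_apply, hy, relChainsMap_relChainsProj, hz, relChainsProj_eq_iff, map_add,
    add_sub_cancel_right, ambientChain_chainsMap]
  exact ambientChain_mem a

/-- Every homology class of `X_i` is represented by a sum of chains of `A_i` and `B_i`, which
determines the Mayer–Vietoris boundary map. -/
lemma IsMayerVietorisBoundary.unique (hAB : interior A ∪ interior B = Set.univ) {k : ℕ} {i : P}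
    {d d' : ((chains R X).obj (F i)).homology (k + 1) ⟶
      ((chains R X).obj (induced F (A ∩ B) i)).homology k}
    (hd : IsMayerVietorisBoundary R (induced_le F A i) (induced_le F B i)
      (inter_le_right F A B i) k d)
    (hd' : IsMayerVietorisBoundary R (induced_le F A i) (induced_le F B i)
      (inter_le_right F A B i) k d') : d = d' := by
  refine ModuleCat.hom_ext (LinearMap.ext fun x => ?_)
  obtain ⟨z, rfl⟩ := exists_homologyπ_eq _ x
  have hdz : singBoundary R (k + 1) (ambientChain R (F i) (k + 1) (((chains R X).obj
      (F i)).iCycles (k + 1) |>.hom z)) = 0 := by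
    rw [← ambientChain_d, d_iCycles, map_zero]
  obtain ⟨a, ha, b, hb, y, hy, hdb, hzab⟩ := exists_relCycle_of_relCycle (A := A) (B := B) hAB
    (ambientChain_mem (((chains R X).obj (F i)).iCycles (k + 1) |>.hom z))
    (by rw [hdz]; exact Submodule.zero_mem _)
  obtain ⟨a, rfl⟩ := exists_ambientChain_eq (S := induced F A i) ha
  obtain ⟨b, rfl⟩ := exists_ambientChain_eq (S := induced F B i) hb
  obtain ⟨y, rfl⟩ := exists_ambientChain_eq hy
  obtain ⟨w, hw⟩ := exists_ambientChain_eq (S := induced F (A ∩ B) i) hdb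
  rw [← ambientChain_d] at hw
  have hw' : ((chainsMap R (inter_le_right F A B i)).f k).hom w =
      (((chains R X).obj (induced F B i)).d (k + 1) k).hom b :=
    ambientChain_injective _ k (by rw [ambientChain_chainsMap, hw])
  have hwc : (((chains R X).obj (induced F (A ∩ B) i)).d k (k - 1)).hom w = 0 := by
    have hinj : Function.Injective ((chainsMap R (inter_le_right F A B i)).f (k - 1)).hom :=
      fun s t hst => ambientChain_injective _ _ (by
        rw [← ambientChain_chainsMap (inter_le_right F A B i), hst, ambientChain_chainsMap])
    refine hinj ?_
    rw [f_d_apply, hw', map_zero]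
    exact congrArg (fun f => f.hom b)
      (((chains R X).obj (induced F B i)).d_comp_d (k + 1) k (k - 1))
  obtain ⟨w, rfl⟩ := exists_iCycles_eq _ hwc
  -- subtract a boundary from `z` to turn it into a sum of chains of `A_i` and `B_i`
  set z' := z - (((chains R X).obj (F i)).toCycles (k + 2) (k + 1)).hom y
  have hz' : (((chains R X).obj (F i)).iCycles (k + 1)).hom z' =
      ((chainsMap R (induced_le F A i)).f (k + 1)).hom a +
        ((chainsMap R (induced_le F B i)).f (k + 1)).hom b := by
    refine ambientChain_injective _ _ ?_
    have h1 : (((chains R X).obj (F i)).iCycles (k + 1)).hom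
        ((((chains R X).obj (F i)).toCycles (k + 2) (k + 1)).hom y) =
          (((chains R X).obj (F i)).d (k + 2) (k + 1)).hom y :=
      congrArg (fun f => f.hom y) (((chains R X).obj (F i)).toCycles_i (k + 2) (k + 1))
    rw [map_sub, h1, map_sub, map_add, ambientChain_chainsMap, ambientChain_chainsMap,
      ambientChain_d, hzab, add_sub_cancel_right]
  have hzz' : (((chains R X).obj (F i)).homologyπ (k + 1)).hom z =
      (((chains R X).obj (F i)).homologyπ (k + 1)).hom z' := by
    have h2 : (((chains R X).obj (F i)).homologyπ (k + 1)).hom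
        ((((chains R X).obj (F i)).toCycles (k + 2) (k + 1)).hom y) = 0 :=
      congrArg (fun f => f.hom y) (((chains R X).obj (F i)).toCycles_comp_homologyπ (k + 2) (k + 1))
    rw [map_sub, h2, sub_zero]
  rw [hzz', hd z' a b w hz' hw', hd' z' a b w hz' hw']

lemma pMayerVietoris_comp_inter_left (hAB : interior A ∪ interior B = Set.univ) (k : ℕ) :
    pMayerVietoris R F A B hAB k ≫ pInclusion R (inter_le_left F A B) k = 0 := by
  have := isIso_pExcision R F A B hAB (k + 1)
  have h : pBoundary R (inter_le_right F A B) k ≫ pInclusion R (inter_le_left F A B) k =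
      pExcision R F A B (k + 1) ≫ pBoundary R (induced_le F A) k :=
    pBoundary_comp_pInclusion_eq ..
  rw [pMayerVietoris, Category.assoc, Category.assoc, h, IsIso.inv_hom_id_assoc,
    pQuotient_comp_pBoundary]

lemma pMayerVietoris_comp_inter_right (hAB : interior A ∪ interior B = Set.univ) (k : ℕ) :
    pMayerVietoris R F A B hAB k ≫ pInclusion R (inter_le_right F A B) k = 0 := by
  rw [pMayerVietoris, Category.assoc, Category.assoc, pBoundary_comp_pInclusion, comp_zero,
    comp_zero]

lemma pInclusion_left_comp_pMayerVietoris (hAB : interior A ∪ interior B = Set.univ) (k : ℕ) :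
    pInclusion R (induced_le F A) (k + 1) ≫ pMayerVietoris R F A B hAB k = 0 := by
  rw [pMayerVietoris, ← Category.assoc, pInclusion_comp_pQuotient, zero_comp]

lemma pInclusion_right_comp_pMayerVietoris (hAB : interior A ∪ interior B = Set.univ) (k : ℕ) :
    pInclusion R (induced_le F B) (k + 1) ≫ pMayerVietoris R F A B hAB k = 0 := by
  have := isIso_pExcision R F A B hAB (k + 1)
  have h : pInclusion R (induced_le F B) (k + 1) ≫ pQuotient R (induced_le F A) (k + 1) =
      pQuotient R (inter_le_right F A B) (k + 1) ≫ pExcision R F A B (k + 1) :=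
    (pQuotient_comp_pRelInclusion ..).symm
  rw [pMayerVietoris, reassoc_of% h, IsIso.hom_inv_id_assoc, pQuotient_comp_pBoundary]

end FiltrationMorphisms

end PersistentMV

theorem mainTheorem3 {X : Type u} [TopologicalSpace X] {P : Type w} [PartialOrder P]
    (R : Type u) [CommRing R] (F : P →o Set X) (A B : Set X)
    (hAB : interior A ∪ interior B = Set.univ) :
    ∃ δ : ∀ k : ℕ, pHomology R F (k + 1) ⟶ pHomology R (induced F (A ∩ B)) k,
      -- `δ_k` at each `i` is the Mayer–Vietoris boundary map of `(X_i, A_i, B_i)`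
      (∀ (k : ℕ) (i : P),
        IsMayerVietorisBoundary R (induced_le F A i) (induced_le F B i)
          (inter_le_right F A B i) k ((δ k).app i) ∧
        ∀ d, IsMayerVietorisBoundary R (induced_le F A i) (induced_le F B i)
          (inter_le_right F A B i) k d → d = (δ k).app i) ∧
      ∀ (i j : P) (hij : i ≤ j),
        -- persistent excision, and `ω = ∂_B ∘ excision⁻¹ ∘ κ_X`
        (∃ hexc : ∀ k : ℕ, Function.Bijective (persistentMap (pExcision R F A B k) hij),
          ∀ k : ℕ, persistentMap (δ k) hij =
            persistentMap (pBoundary R (inter_le_right F A B) k) hij ∘ₗ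
              (LinearEquiv.ofBijective (persistentMap (pExcision R F A B (k + 1)) hij)
                (hexc (k + 1))).symm.toLinearMap ∘ₗ
              persistentMap (pQuotient R (induced_le F A) (k + 1)) hij) ∧
        -- the persistent long sequences of the pairs `(X, A)` and `(B, A ∩ B)` are complexes
        PairSequenceIsComplex R (induced_le F A) hij ∧
        PairSequenceIsComplex R (inter_le_right F A B) hij ∧
        -- the ladder formed by these two sequences commutes
        (∀ k : ℕ,
          persistentMap (pExcision R F A B k) hij ∘ₗ
              persistentMap (pQuotient R (inter_le_right F A B) k) hij =
            persistentMap (pQuotient R (induced_le F A) k) hij ∘ₗ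
              persistentMap (pInclusion R (induced_le F B) k) hij ∧
          persistentMap (pInclusion R (inter_le_left F A B) k) hij ∘ₗ
              persistentMap (pBoundary R (inter_le_right F A B) k) hij =
            persistentMap (pBoundary R (induced_le F A) k) hij ∘ₗ
              persistentMap (pExcision R F A B (k + 1)) hij ∧
          persistentMap (pInclusion R (induced_le F B) k) hij ∘ₗ
              persistentMap (pInclusion R (inter_le_right F A B) k) hij =
            persistentMap (pInclusion R (induced_le F A) k) hij ∘ₗ
              persistentMap (pInclusion R (inter_le_left F A B) k) hij) ∧
        -- the persistent Mayer–Vietoris sequence is a complex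
        (∀ k : ℕ,
          LinearMap.range (persistentMap (δ k) hij) ≤
            LinearMap.ker (mvAlphaBeta R F A B hij k) ∧
          LinearMap.range (mvAlphaBeta R F A B hij k) ≤
            LinearMap.ker (mvDifference R F A B hij k) ∧
          LinearMap.range (mvDifference R F A B hij (k + 1)) ≤
            LinearMap.ker (persistentMap (δ k) hij)) := by
  have := fun k => isIso_pExcision R F A B hAB k
  refine ⟨pMayerVietoris R F A B hAB, fun k i =>
    ⟨isMayerVietorisBoundary_pMayerVietoris hAB k i, fun d hd =>
      hd.unique hAB (isMayerVietorisBoundary_pMayerVietoris hAB k i)⟩, fun i j hij =>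
    ⟨⟨fun k => persistentMap_bijective _ hij, fun k => ?_⟩, pairSequenceIsComplex R _ hij,
      pairSequenceIsComplex R _ hij, fun k => ⟨?_, ?_, ?_⟩, fun k => ⟨?_, ?_, ?_⟩⟩⟩
  · ext1 x
    set e := LinearEquiv.ofBijective (persistentMap (pExcision R F A B (k + 1)) hij)
      (persistentMap_bijective _ hij)
    have he : e.symm (persistentMap (pQuotient R (induced_le F A) (k + 1)) hij x) =
        persistentMap (inv (pExcision R F A B (k + 1))) hij
          (persistentMap (pQuotient R (induced_le F A) (k + 1)) hij x) := by
      rw [LinearEquiv.symm_apply_eq, LinearEquiv.ofBijective_apply, ← LinearMap.comp_apply,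
        ← persistentMap_comp, IsIso.inv_hom_id]
      rfl
    simp only [LinearMap.comp_apply, LinearEquiv.coe_coe]
    rw [he]
    rfl
  · rw [← persistentMap_comp, ← persistentMap_comp, ← pQuotient_comp_pRelInclusion]
    rfl
  · rw [← persistentMap_comp, ← persistentMap_comp]
    exact congrArg (fun φ => persistentMap φ hij) (pBoundary_comp_pInclusion_eq ..)
  · rw [← persistentMap_comp, ← persistentMap_comp, pInclusion_comp, pInclusion_comp]
  · rw [mvAlphaBeta, LinearMap.ker_prod]
    exact le_inf (range_persistentMap_le_ker (pMayerVietoris_comp_inter_left hAB k) hij)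
      (range_persistentMap_le_ker (pMayerVietoris_comp_inter_right hAB k) hij)
  · rw [LinearMap.range_le_ker_iff, mvAlphaBeta, mvDifference, LinearMap.coprod_comp_prod,
      LinearMap.neg_comp, ← persistentMap_comp, ← persistentMap_comp, pInclusion_comp,
      pInclusion_comp, add_neg_cancel]
  · rw [mvDifference, LinearMap.range_coprod, LinearMap.range_neg]
    exact sup_le (range_persistentMap_le_ker (pInclusion_left_comp_pMayerVietoris hAB k) hij)
      (range_persistentMap_le_ker (pInclusion_right_comp_pMayerVietoris hAB k) hij)
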